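/- Let $1\le p<2$ and $s<\frac1p-1$. Let $\nu$ be a symmetric Lévy measure on $\mathbb{R}\setminus\{0\}$ (so $\int\min(1,z^2)\,\nu(dz)<\infty$) with $\int_{|z|\le1}|z|^p\,\nu(dz)<\infty$, and let $\eta$ be a Poisson random measure on $[0,\infty)\times\mathbb{R}$ with intensity $dt\otimes\nu(dz)$ over a probability space $(\Omega,\mathcal F,\mathbb P)$. Let $E=B^s_{p,p}(0,1)$ be the Besov space of real distributions on $(0,1)$, i.e. the space of restrictions to $(0,1)$ of elements of $B^s_{p,p}(\mathbb{R})$ with the quotient norm. For $\varepsilon\in(0,1]$ let $\xi_\varepsilon$ be the truncated noise, i.e. the random distribution $$\xi_\varepsilon(\varphi)=\int_0^1\int_{|z|>\varepsilon}\varphi(t)\,z\,\eta(dz,dt),\qquad \varphi\in C_c^\infty(0,1).$$ Then $C_c^\infty(0,1)\subset E'$, and $\xi_\varepsilon$ is (almost surely equal to) an $E$-valued random variable. For every $\ell\in E'$ the limit in probability $\xi(\ell)=\lim_{\varepsilon\to0}\ell(\xi_\varepsilon)$ exists, and $\eta$ induces a Radon probability measure $\mu$ on $E$: there is a Borel probability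 measure $\mu$ on $E$, inner regular with respect to compact sets, such that for all $n$, all $\ell_1,\dots,\ell_n\in E'$ and all Borel sets $C\subset\mathbb{R}^n$, $$\mu\big(\{x\in E:(\ell_1(x),\dots,\ell_n(x))\in C\}\big)=\mathbb P\big((\xi(\ell_1),\dots,\xi(\ell_n))\in C\big).$$ Moreover, the truncated noises satisfy the following bounds. 1. If in addition $\int_{|z|>1}|z|^p\,\nu(dz)<\infty$, then there is a constant $C$ such that $\mathbb E\,|\xi_\varepsilon|_{E}^p\le C$ for all $\varepsilon\in(0,1]$. 2. There is a constant $C$ such that for all $0<\varepsilon_1\le\varepsilon_2\le1$, $$\mathbb E\,|\xi_{\varepsilon_1}-\xi_{\varepsilon_2}|_{E}^p\le C\int_{\varepsilon_1<|z|\le\varepsilon_2}|z|^p\,\nu(dz).$$ In particular, $(\xi_\varepsilon)$ is Cauchy in $L^p$ as $\varepsilon\to0$. -/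

import Mathlib

open MeasureTheory ProbabilityTheory Filter Topology TopologicalSpace
open scoped ENNReal NNReal SchwartzMap Distributions

noncomputable section

namespace LevyNoise

/-! ### The Besov space `B^s_{p,p}(0,1)` of real-valued distributions -/

/-- The open interval `(0,1)`. -/
def openUnitInterval : Opens ℝ := ⟨Set.Ioo 0 1, isOpen_Ioo⟩

/-- The smooth even cut-off `φ₀`, equal to `1` on `[-1, 1]` and supported in `[-3/2, 3/2]`. -/
def cutoff : ContDiffBump (0 : ℝ) where
  rIn := 1
  rOut := 3 / 2
  rIn_pos := by norm_num
  rIn_lt_rOut := by norm_num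

/-- The dyadic resolution of unity `φ₀`, `φ_{j+1}(x) = φ₀(2^{-(j+1)} x) - φ₀(2^{-j} x)`. -/
def dyadic : ℕ → ℝ → ℝ
  | 0 => fun x => cutoff x
  | j + 1 => fun x => cutoff (x / 2 ^ (j + 1)) - cutoff (x / 2 ^ j)

/-- The Littlewood-Paley block `f ↦ 𝓕⁻¹ (φ_j 𝓕 f)` on tempered distributions on the line. -/
def block (j : ℕ) : 𝓢'(ℝ, ℂ) →L[ℂ] 𝓢'(ℝ, ℂ) :=
  TemperedDistribution.fourierMultiplierCLM ℂ (fun x => (dyadic j x : ℂ))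

/-- The space `ℓ^p(ℕ; L^p(ℝ; ℂ))`, whose norm is `(∑_j ‖a_j‖_{L^p}^p)^{1/p}` for `p < ∞`. -/
abbrev SeqLp (p : ℝ≥0∞) [Fact (1 ≤ p)] : Type :=
  lp (fun _ : ℕ => Lp ℂ p (volume : Measure ℝ)) p

/-- The blocks of `f`, weighted by `2^{js}`, are the `L^p` functions `a_j`. A tempered distribution
`f` is in `B^s_{p,p}(ℝ)` if and only if there is such an `a` in `ℓ^p(ℕ; L^p)`; then
`‖f‖_{B^s_{p,p}} = (∑_j 2^{jsp} ‖𝓕⁻¹ (φ_j 𝓕 f)‖_{L^p}^p)^{1/p}` is the norm of `a`. -/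
def HasBlocks {p : ℝ≥0∞} [Fact (1 ≤ p)] (s : ℝ) (f : 𝓢'(ℝ, ℂ)) (a : SeqLp p) : Prop :=
  ∀ j : ℕ, (((2 : ℝ) ^ ((j : ℝ) * s) : ℝ) : ℂ) • block j f = Lp.toTemperedDistribution (a j)

/-- A real test function on `(0,1)`, seen as a complex Schwartz function on the line. -/
def toSchwartz (φ : 𝓓(openUnitInterval, ℝ)) : 𝓢(ℝ, ℂ) :=
  HasCompactSupport.toSchwartzMap (f := fun x => (φ x : ℂ))
    (φ.hasCompactSupport.comp_left (g := Complex.ofReal) Complex.ofReal_zero)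
    (Complex.ofRealCLM.contDiff.comp φ.contDiff)

/-- The tempered distribution `f` restricts to the real distribution `T` on `(0,1)`. -/
def IsExtension (f : 𝓢'(ℝ, ℂ)) (T : 𝓓'(openUnitInterval, ℝ)) : Prop :=
  ∀ φ : 𝓓(openUnitInterval, ℝ), f (toSchwartz φ) = (T φ : ℂ)

lemma toSchwartz_apply (φ : 𝓓(openUnitInterval, ℝ)) (x : ℝ) : toSchwartz φ x = (φ x : ℂ) := rfl

lemma isExtension_zero : IsExtension 0 0 := by
  intro φ
  have h : (0 : 𝓓'(openUnitInterval, ℝ)) φ = 0 := rfl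
  rw [h]
  simp

lemma IsExtension.add {f g : 𝓢'(ℝ, ℂ)} {T U : 𝓓'(openUnitInterval, ℝ)}
    (hf : IsExtension f T) (hg : IsExtension g U) : IsExtension (f + g) (T + U) := by
  intro φ
  have h : (T + U) φ = T φ + U φ := rfl
  have h' : (f + g) (toSchwartz φ) = f (toSchwartz φ) + g (toSchwartz φ) := rfl
  rw [h, h', hf φ, hg φ, Complex.ofReal_add]

lemma IsExtension.smul {f : 𝓢'(ℝ, ℂ)} {T : 𝓓'(openUnitInterval, ℝ)}
    (hf : IsExtension f T) (c : ℝ) : IsExtension ((c : ℂ) • f) (c • T) := by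
  intro φ
  have h : (c • T) φ = c * T φ := rfl
  have h' : ((c : ℂ) • f) (toSchwartz φ) = (c : ℂ) * f (toSchwartz φ) := rfl
  rw [h, h', hf φ, Complex.ofReal_mul]

section HasBlocks

variable {p : ℝ≥0∞} [Fact (1 ≤ p)] {s : ℝ} {f g : 𝓢'(ℝ, ℂ)} {a b : SeqLp p}

lemma hasBlocks_zero : HasBlocks s 0 (0 : SeqLp p) := by
  intro j
  rw [map_zero]
  refine (smul_zero (A := 𝓢'(ℝ, ℂ)) (((2 : ℝ) ^ ((j : ℝ) * s) : ℝ) : ℂ)).trans ?_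
  exact (map_zero (Lp.toTemperedDistributionCLM ℂ (volume : Measure ℝ) p)).symm

lemma HasBlocks.add (hf : HasBlocks s f a) (hg : HasBlocks s g b) :
    HasBlocks s (f + g) (a + b) := by
  intro j
  rw [map_add, smul_add, hf j, hg j]
  exact (map_add (Lp.toTemperedDistributionCLM ℂ (volume : Measure ℝ) p) (a j) (b j)).symm

lemma HasBlocks.smul (hf : HasBlocks s f a) (c : ℂ) : HasBlocks s (c • f) (c • a) := by
  intro j
  rw [map_smul, smul_comm, hf j]
  exact (map_smul (Lp.toTemperedDistributionCLM ℂ (volume : Measure ℝ) p) c (a j)).symm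

end HasBlocks

/-- The real distributions on `(0,1)` that are restrictions of elements of `B^s_{p,p}(ℝ)`. -/
def besovSubmodule (s : ℝ) (p : ℝ≥0∞) [Fact (1 ≤ p)] :
    Submodule ℝ 𝓓'(openUnitInterval, ℝ) where
  carrier := {T | ∃ f, ∃ a : SeqLp p, IsExtension f T ∧ HasBlocks s f a}
  zero_mem' := ⟨0, 0, isExtension_zero, hasBlocks_zero⟩
  add_mem' := by
    rintro T U ⟨f, a, hf, ha⟩ ⟨g, b, hg, hb⟩
    exact ⟨f + g, a + b, hf.add hg, ha.add hb⟩
  smul_mem' := by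
    rintro c T ⟨f, a, hf, ha⟩
    exact ⟨(c : ℂ) • f, (c : ℂ) • a, hf.smul c, ha.smul c⟩

/-- The Besov space `B^s_{p,p}(0,1)` of real distributions on `(0,1)`. It carries the quotient norm
defined below, not the topology induced by the space of distributions. -/
def Besov (s : ℝ) (p : ℝ≥0∞) [Fact (1 ≤ p)] : Type := besovSubmodule s p

namespace Besov

variable {s : ℝ} {p : ℝ≥0∞} [Fact (1 ≤ p)]

instance : AddCommGroup (Besov s p) := inferInstanceAs (AddCommGroup (besovSubmodule s p))

instance : Module ℝ (Besov s p) := inferInstanceAs (Module ℝ (besovSubmodule s p))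

/-- The distribution on `(0,1)` underlying an element of the Besov space. -/
def toDistribution : Besov s p →ₗ[ℝ] 𝓓'(openUnitInterval, ℝ) := (besovSubmodule s p).subtype

/-- The norms of the tempered extensions of `x` in `B^s_{p,p}(ℝ)`. -/
def extensionNorms (x : Besov s p) : Set ℝ :=
  {r | ∃ f, ∃ a : SeqLp p, IsExtension f x.toDistribution ∧ HasBlocks s f a ∧ ‖a‖ = r}

lemma extensionNorms_nonempty (x : Besov s p) : x.extensionNorms.Nonempty := by
  obtain ⟨f, a, hf, ha⟩ := x.2
  exact ⟨‖a‖, f, a, hf, ha, rfl⟩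

lemma nonneg_of_mem {x : Besov s p} {r : ℝ} (h : r ∈ x.extensionNorms) : 0 ≤ r := by
  obtain ⟨f, a, -, -, rfl⟩ := h
  exact norm_nonneg a

lemma bddBelow_extensionNorms (x : Besov s p) : BddBelow x.extensionNorms :=
  ⟨0, fun _ h => nonneg_of_mem h⟩

/-- The norm of `B^s_{p,p}(0,1)`: the infimum of the norms in `B^s_{p,p}(ℝ)` of all extensions.
Complex extensions are allowed; since the `φ_j` are real and even, passing to the real part of an
extension does not increase its norm, so real extensions give the same infimum. -/
instance : Norm (Besov s p) := ⟨fun x => sInf x.extensionNorms⟩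

lemma norm_def (x : Besov s p) : ‖x‖ = sInf x.extensionNorms := rfl

lemma norm_le_of_mem {x : Besov s p} {r : ℝ} (h : r ∈ x.extensionNorms) : ‖x‖ ≤ r :=
  csInf_le x.bddBelow_extensionNorms h

lemma norm_smul_le' (c : ℝ) (x : Besov s p) : ‖c • x‖ ≤ |c| * ‖x‖ := by
  rw [norm_def x, ← smul_eq_mul, ← Real.sInf_smul_of_nonneg (abs_nonneg c)]
  refine le_csInf (x.extensionNorms_nonempty.image _) ?_
  rintro _ ⟨r, ⟨f, a, hf, ha, rfl⟩, rfl⟩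
  refine norm_le_of_mem ⟨(c : ℂ) • f, (c : ℂ) • a, ?_, ha.smul c, ?_⟩
  · rw [map_smul]
    exact hf.smul c
  · exact (norm_smul (c : ℂ) a).trans (by rw [Complex.norm_real, Real.norm_eq_abs]; rfl)

lemma norm_add_le' (x y : Besov s p) : ‖x + y‖ ≤ ‖x‖ + ‖y‖ := by
  refine le_of_forall_pos_lt_add fun δ hδ => ?_
  obtain ⟨r, hr, hrx⟩ := exists_lt_of_csInf_lt x.extensionNorms_nonempty
    (show sInf x.extensionNorms < ‖x‖ + δ / 2 by rw [← norm_def]; linarith)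
  obtain ⟨t, ht, hty⟩ := exists_lt_of_csInf_lt y.extensionNorms_nonempty
    (show sInf y.extensionNorms < ‖y‖ + δ / 2 by rw [← norm_def]; linarith)
  obtain ⟨f, a, hf, ha, rfl⟩ := hr
  obtain ⟨g, b, hg, hb, rfl⟩ := ht
  have h : ‖x + y‖ ≤ ‖a + b‖ := by
    refine norm_le_of_mem ⟨f + g, a + b, ?_, ha.add hb, rfl⟩
    rw [map_add]
    exact hf.add hg
  have := norm_add_le a b
  linarith

lemma core : SeminormedSpace.Core ℝ (Besov s p) where
  norm_nonneg x := le_csInf x.extensionNorms_nonempty fun _ h => nonneg_of_mem h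
  norm_smul c x := by
    refine le_antisymm (norm_smul_le' c x) ?_
    rcases eq_or_ne c 0 with rfl | hc
    · have h : 0 ≤ ‖(0 : ℝ) • x‖ :=
        le_csInf (extensionNorms_nonempty _) fun _ h => nonneg_of_mem h
      simpa using h
    · have h := norm_smul_le' c⁻¹ (c • x)
      rw [smul_smul, inv_mul_cancel₀ hc, one_smul, abs_inv] at h
      rw [Real.norm_eq_abs]
      calc |c| * ‖x‖ ≤ |c| * (|c|⁻¹ * ‖c • x‖) := by gcongr
        _ = ‖c • x‖ := by rw [← mul_assoc, mul_inv_cancel₀ (abs_ne_zero.mpr hc), one_mul]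
  norm_triangle := norm_add_le'

/-- Only the seminorm axioms are recorded here; that the norm is definite is a theorem. -/
instance : SeminormedAddCommGroup (Besov s p) := SeminormedAddCommGroup.ofCore core

instance : NormedSpace ℝ (Besov s p) where
  norm_smul_le c x := norm_smul_le' c x

instance : MeasurableSpace (Besov s p) := borel _

instance : BorelSpace (Besov s p) := ⟨rfl⟩

end Besov

/-! ### Lévy measures, Poisson random measures and the truncated noise -/

/-- `ν` is a Lévy measure on `ℝ ∖ {0}`. -/
structure IsLevyMeasure (ν : Measure ℝ) : Prop where
  measure_zero : ν {0} = 0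
  lintegral_lt_top : ∫⁻ z, ENNReal.ofReal (min 1 (z ^ 2)) ∂ν < ∞

/-- `η` is a Poisson random measure with intensity `m` over the probability space `(Ω, P)`. -/
structure IsPoissonRandomMeasure {Ω E : Type*} [MeasurableSpace Ω] [MeasurableSpace E]
    (η : Ω → Measure E) (m : Measure E) (P : Measure Ω) : Prop where
  measurable : ∀ A, MeasurableSet A → Measurable fun ω => η ω A
  law : ∀ A, MeasurableSet A → m A ≠ ∞ →
    P.map (fun ω => η ω A) = (poissonMeasure (m A).toNNReal).map (fun n : ℕ => (n : ℝ≥0∞))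
  eq_top : ∀ A, MeasurableSet A → m A = ∞ → ∀ᵐ ω ∂P, η ω A = ∞
  indep : ∀ (n : ℕ) (A : Fin n → Set E), (∀ i, MeasurableSet (A i)) →
    Pairwise (Function.onFun Disjoint A) → iIndepFun (fun i ω => η ω (A i)) P

/-- The intensity of a time-homogeneous Poisson random measure on `ℝ` with Lévy measure `ν`: the
measure `dt ⊗ ν(dz)` on `[0,∞) × ℝ`. The first coordinate is the time, the second the jump. -/
def homogeneousIntensity (ν : Measure ℝ) : Measure (ℝ × ℝ) :=
  (volume.restrict (Set.Ici 0)).prod ν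

/-- Times in `[0,1]` and jumps of size larger than `ε`. -/
def jumpSet (ε : ℝ) : Set (ℝ × ℝ) := Set.Icc 0 1 ×ˢ {z | ε < |z|}

/-- `ξ_ε(φ) = ∫₀¹ ∫_{|z| > ε} φ(t) z η(dz, dt)`, for one realization `η` of the measure. -/
def truncatedNoise (η : Measure (ℝ × ℝ)) (ε : ℝ) (φ : ℝ → ℝ) : ℝ :=
  ∫ x in jumpSet ε, φ x.1 * x.2 ∂η

end LevyNoise

end

namespace LevyNoise

/-! ### Moments of Poisson variables -/

/-! The noise `ξ_ε` is the sum of `z δ_t` over the jumps `(t, z)` with `t ≤ 1` and `|z| > ε`, so two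
things are needed: Dirac masses must form a bounded continuous curve in a good Banach space, and
sums of independent symmetric vectors in that space must have controlled `p`-th moments.

The Besov space is available only as a seminormed quotient, so all integration takes place in
`primitiveSpace`: pairs of a real `L^p` function `g` and the weighted Littlewood-Paley blocks of
`g'`. This is a closed subspace of a product of separable Banach spaces, hence complete and
separable, and `toBesov` maps it continuously to the Besov space by restricting `g'` to `(0,1)`. The
function `-1_{(0,t]}` has derivative `δ_t - δ_0`, and `δ_0` is invisible to test functions on
`(0,1)`. By scaling, the `j`-th block of a Dirac mass has `L^p` norm of order at most
`2^{j(1-1/p)}`, so the weighted blocks are summable when `s < 1/p - 1` (`exists_diracCurve`).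

For `q ≤ 2` the Clarkson inequality holds in Hilbert spaces, and with `q = p` it passes to `L^p` and
`ℓ^p(L^p)`. It gives `E‖S + Z‖^q ≤ E‖S‖^q + E‖Z‖^q` when `Z` is symmetric and independent of `S`.
Since `ν` is symmetric and `z D(t)` is odd in `z`, the integral over jumps in a symmetric set is a
limit of sums of terms `(η(A) - η(A')) c`, with `A'` the reflection of `A`. Such a difference of
counts is an integer, so its `q`-th moment is at most its variance `2 m(A)`. Hence `E‖∫ z D(t) dη‖^p
≤ K ∫_S |z|^p dν` (`lintegral_jumpIntegral_rpow_le`, `exists_lintegral_jumpIntegral_primitive_le`).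

Both moment bounds follow, and the differences of truncated integrals are Cauchy in `L^p(P)`. The
limit `Y` lives in `primitiveSpace`; `ξ(ℓ)` is `ℓ` applied to the image of `Y`, and `μ` is the law
of that image. A probability law on a complete separable space is inner regular for compact sets,
and a continuous map preserves this, so `μ` is Radon. -/

lemma hasSum_poisson_factorial_moment (r : ℝ≥0) (k : ℕ) :
    HasSum (fun n : ℕ => Real.exp (-r) * r ^ n / n.factorial * (n.descFactorial k : ℝ))
      ((r : ℝ) ^ k) := by
  have hshift : HasSum (fun n : ℕ =>
      Real.exp (-r) * r ^ (n + k) / (n + k).factorial * ((n + k).descFactorial k : ℝ))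
      ((r : ℝ) ^ k) := by
    have h := (hasSum_one_poissonMeasure r).mul_left ((r : ℝ) ^ k)
    rw [mul_one] at h
    refine h.congr_fun fun n => ?_
    have h1 := Nat.factorial_mul_descFactorial (Nat.le_add_left k n)
    rw [Nat.add_sub_cancel] at h1
    have h2 : ((n + k).factorial : ℝ) = n.factorial * (n + k).descFactorial k := by
      exact_mod_cast h1.symm
    have h3 : (n.factorial : ℝ) ≠ 0 := by positivity
    have h4 : ((n + k).descFactorial k : ℝ) ≠ 0 := by
      intro h
      rw [h, mul_zero] at h2
      exact (Nat.cast_ne_zero.mpr (n + k).factorial_ne_zero) h2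
    rw [h2, pow_add]
    field_simp
  -- The first `k` terms vanish because `n.descFactorial k = 0` for `n < k`; the remaining ones are
  -- `r ^ k` times the Poisson weights.
  refine (hasSum_nat_add_iff' (f := fun n : ℕ =>
    Real.exp (-r) * r ^ n / n.factorial * (n.descFactorial k : ℝ)) k).mp ?_
  rw [Finset.sum_eq_zero, sub_zero]
  · exact hshift
  · intro i hi
    rw [Nat.descFactorial_of_lt (Finset.mem_range.mp hi)]
    simp

lemma integrable_descFactorial_poissonMeasure (r : ℝ≥0) (k : ℕ) :
    Integrable (fun n : ℕ => (n.descFactorial k : ℝ)) (poissonMeasure r) := by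
  rw [integrable_poissonMeasure_iff]
  simpa using (hasSum_poisson_factorial_moment r k).summable

lemma integral_descFactorial_poissonMeasure (r : ℝ≥0) (k : ℕ) :
    ∫ n : ℕ, (n.descFactorial k : ℝ) ∂poissonMeasure r = (r : ℝ) ^ k := by
  rw [integral_poissonMeasure' (integrable_descFactorial_poissonMeasure r k)]
  simpa using (hasSum_poisson_factorial_moment r k).tsum_eq

lemma natCast_sq_eq_descFactorial (n : ℕ) :
    (n : ℝ) ^ 2 = (n.descFactorial 2 : ℝ) + (n.descFactorial 1 : ℝ) := by
  rcases n with _ | n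
  · simp
  · simp [Nat.descFactorial_succ]
    ring

lemma memLp_two_natCast_poissonMeasure (r : ℝ≥0) :
    MemLp (fun n : ℕ => (n : ℝ)) 2 (poissonMeasure r) := by
  rw [memLp_two_iff_integrable_sq (by fun_prop)]
  simp_rw [natCast_sq_eq_descFactorial]
  exact (integrable_descFactorial_poissonMeasure r 2).add
    (integrable_descFactorial_poissonMeasure r 1)

lemma variance_natCast_poissonMeasure (r : ℝ≥0) :
    variance (fun n : ℕ => (n : ℝ)) (poissonMeasure r) = r := by
  rw [variance_eq_sub (memLp_two_natCast_poissonMeasure r)]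
  have h1 := integral_descFactorial_poissonMeasure r 1
  simp only [Nat.descFactorial_one, pow_one] at h1
  simp only [Pi.pow_apply, h1]
  simp_rw [natCast_sq_eq_descFactorial]
  rw [integral_add (integrable_descFactorial_poissonMeasure r 2)
    (integrable_descFactorial_poissonMeasure r 1), integral_descFactorial_poissonMeasure,
    integral_descFactorial_poissonMeasure]
  ring

/-! ### Counts of a Poisson random measure on disjoint sets -/

section PoissonRandomMeasure

variable {Ω E : Type*} [MeasurableSpace Ω] [MeasurableSpace E] {P : Measure Ω}
  {η : Ω → Measure E} {m : Measure E}

lemma IsPoissonRandomMeasure.measurable_real (hη : IsPoissonRandomMeasure η m P) {A : Set E}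
    (hA : MeasurableSet A) : Measurable fun ω => (η ω).real A :=
  (hη.measurable A hA).ennreal_toReal

/-- Integrality is read off from the law. It serves twice: to bound `|k|^q` by `k^2` for differences
of counts, and to turn a count below one into no jump at all. -/
lemma IsPoissonRandomMeasure.ae_exists_nat (hη : IsPoissonRandomMeasure η m P) {A : Set E}
    (hA : MeasurableSet A) (hmA : m A ≠ ∞) : ∀ᵐ ω ∂P, ∃ n : ℕ, η ω A = n := by
  have h : ∀ᵐ x ∂P.map (fun ω => η ω A), x ∈ Set.range (fun n : ℕ => (n : ℝ≥0∞)) := by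
    rw [hη.law A hA hmA]
    have hr : MeasurableSet (Set.range (fun n : ℕ => (n : ℝ≥0∞))) :=
      (Set.countable_range _).measurableSet
    refine (ae_map_iff (measurable_of_countable _).aemeasurable hr).mpr ?_
    exact ae_of_all _ fun n => ⟨n, rfl⟩
  filter_upwards [ae_of_ae_map (hη.measurable A hA).aemeasurable h] with ω hω
  obtain ⟨n, hn⟩ := hω
  exact ⟨n, hn.symm⟩

lemma IsPoissonRandomMeasure.ae_lt_top (hη : IsPoissonRandomMeasure η m P) {A : Set E}
    (hA : MeasurableSet A) (hmA : m A ≠ ∞) : ∀ᵐ ω ∂P, η ω A < ∞ := by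
  filter_upwards [hη.ae_exists_nat hA hmA] with ω ⟨n, hn⟩
  rw [hn]
  exact ENNReal.natCast_lt_top n

lemma IsPoissonRandomMeasure.identDistrib (hη : IsPoissonRandomMeasure η m P) {A : Set E}
    (hA : MeasurableSet A) (hmA : m A ≠ ∞) :
    IdentDistrib (fun ω => (η ω).real A) (fun n : ℕ => (n : ℝ)) P
      (poissonMeasure (m A).toNNReal) where
  aemeasurable_fst := (hη.measurable_real hA).aemeasurable
  aemeasurable_snd := by fun_prop
  map_eq := by
    have h1 : (fun ω => (η ω).real A) = ENNReal.toReal ∘ fun ω => η ω A := rfl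
    have h2 : (fun n : ℕ => (n : ℝ)) = ENNReal.toReal ∘ fun n : ℕ => (n : ℝ≥0∞) := by
      ext n; simp
    rw [h1, h2, ← Measure.map_map ENNReal.measurable_toReal (hη.measurable A hA), hη.law A hA hmA,
      Measure.map_map ENNReal.measurable_toReal (by fun_prop)]

lemma IsPoissonRandomMeasure.iIndepFun_real (hη : IsPoissonRandomMeasure η m P) {ι : Type*}
    [Fintype ι] (A : ι → Set E) (hA : ∀ i, MeasurableSet (A i))
    (hd : Pairwise (Function.onFun Disjoint A)) : iIndepFun (fun i ω => (η ω).real (A i)) P := by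
  let e := Fintype.equivFin ι
  have h := hη.indep _ (A ∘ e.symm) (fun i => hA _) (hd.comp_of_injective e.symm.injective)
  have h' := (h.precomp e.injective).comp (fun _ => ENNReal.toReal)
    (fun _ => ENNReal.measurable_toReal)
  have heq : (fun i => ENNReal.toReal ∘ fun ω => η ω ((A ∘ e.symm) (e i))) =
      fun i ω => (η ω).real (A i) := by
    funext i ω
    simp [Measure.real]
  rwa [heq] at h'

lemma IsPoissonRandomMeasure.indepFun_real (hη : IsPoissonRandomMeasure η m P) {A B : Set E}
    (hA : MeasurableSet A) (hB : MeasurableSet B) (hAB : Disjoint A B) :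
    IndepFun (fun ω => (η ω).real A) (fun ω => (η ω).real B) P := by
  have h := hη.iIndepFun_real (fun b : Bool => if b then A else B)
    (by rintro (_ | _) <;> simpa)
    (by
      rintro (_ | _) (_ | _) hne <;> simp_all [Function.onFun, disjoint_comm])
  simpa using h.indepFun (show true ≠ false by decide)

variable [IsProbabilityMeasure P]

/-- The difference is almost surely an integer `k`, and `|k|^q ≤ k^2` for `0 < q ≤ 2`. Its mean is
zero, so the second moment is the sum of the two Poisson variances. The bound is linear in `m A`,
also for small `m A`. -/
lemma IsPoissonRandomMeasure.lintegral_sub_rpow_le (hη : IsPoissonRandomMeasure η m P)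
    {A B : Set E} (hA : MeasurableSet A) (hB : MeasurableSet B) (hAB : Disjoint A B)
    (hmA : m A ≠ ∞) (hm : m B = m A) {q : ℝ} (hq : 0 < q) (hq2 : q ≤ 2) :
    ∫⁻ ω, ‖(η ω).real A - (η ω).real B‖ₑ ^ q ∂P ≤ 2 * m A := by
  have hmB : m B ≠ ∞ := hm ▸ hmA
  have hlA := hη.identDistrib hA hmA
  have hlB := hη.identDistrib hB hmB
  have hA2 : MemLp (fun ω => (η ω).real A) 2 P :=
    hlA.memLp_iff.mpr (memLp_two_natCast_poissonMeasure _)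
  have hB2 : MemLp (fun ω => (η ω).real B) 2 P :=
    hlB.memLp_iff.mpr (memLp_two_natCast_poissonMeasure _)
  have hAB2 : MemLp (fun ω => (η ω).real A - (η ω).real B) 2 P := hA2.sub hB2
  have hvar : variance (fun ω => (η ω).real A - (η ω).real B) P = 2 * (m A).toReal := by
    have h := ((hη.indepFun_real hA hB hAB).comp measurable_id measurable_neg).variance_add
      hA2 hB2.neg
    rw [variance_neg, hlA.variance_eq, hlB.variance_eq, variance_natCast_poissonMeasure,
      variance_natCast_poissonMeasure, hm] at h
    have h' : (fun ω => (η ω).real A - (η ω).real B) =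
      (fun ω => (η ω).real A) - fun ω => (η ω).real B := rfl
    rw [h', sub_eq_add_neg, h, two_mul]
    rfl
  have hmean : ∫ ω, ((η ω).real A - (η ω).real B) ∂P = 0 := by
    rw [integral_sub (hA2.integrable (by norm_num)) (hB2.integrable (by norm_num)),
      hlA.integral_eq, hlB.integral_eq, hm, sub_self]
  have hsq : ∫⁻ ω, ‖(η ω).real A - (η ω).real B‖ₑ ^ (2 : ℝ) ∂P = 2 * m A := by
    have h := variance_of_integral_eq_zero hAB2.aestronglyMeasurable.aemeasurable hmean
    rw [hvar] at h
    have h2 := ofReal_integral_eq_lintegral_ofReal hAB2.integrable_sq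
      (ae_of_all _ fun ω => sq_nonneg _)
    rw [← h, ENNReal.ofReal_mul (by norm_num), ENNReal.ofReal_toReal hmA] at h2
    rw [ENNReal.ofReal_ofNat] at h2
    rw [h2]
    refine lintegral_congr fun ω => ?_
    rw [← sq_abs, ENNReal.ofReal_pow (abs_nonneg _), ← Real.enorm_eq_ofReal_abs]
    exact ENNReal.rpow_ofNat _ 2
  rw [← hsq]
  refine lintegral_mono_ae ?_
  filter_upwards [hη.ae_exists_nat hA hmA, hη.ae_exists_nat hB hmB] with ω ⟨a, ha⟩ ⟨b, hb⟩
  have hz : (η ω).real A - (η ω).real B = (((a : ℤ) - b : ℤ) : ℝ) := by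
    simp [Measure.real, ha, hb]
  rw [hz]
  rcases eq_or_ne ((a : ℤ) - b) 0 with h0 | h0
  · simp [h0, hq]
  · refine ENNReal.rpow_le_rpow_of_exponent_le ?_ hq2
    rw [Real.enorm_eq_ofReal_abs, ← ENNReal.ofReal_one]
    refine ENNReal.ofReal_le_ofReal ?_
    exact_mod_cast Int.one_le_abs h0

end PoissonRandomMeasure

/-! ### Moments of symmetric Poisson integrals in spaces of type `q` -/

/-- The Clarkson inequality with exponent `q`, which makes `F` a space of type `q`. -/
def ClarksonInequality (F : Type*) [SeminormedAddCommGroup F] (q : ℝ) : Prop :=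
  ∀ u v : F, ‖u + v‖ₑ ^ q + ‖u - v‖ₑ ^ q ≤ 2 * (‖u‖ₑ ^ q + ‖v‖ₑ ^ q)

section TypeInequality

variable {Ω F : Type*} [MeasurableSpace Ω] {P : Measure Ω} [IsProbabilityMeasure P]
  [NormedAddCommGroup F] [MeasurableSpace F] [BorelSpace F] [SecondCountableTopology F] {q : ℝ}

/-- By symmetry and independence `S - Z` has the law of `S + Z`, so integrating the Clarkson
inequality gives twice the claim. -/
lemma lintegral_enorm_add_rpow_le (hF : ClarksonInequality F q) {S Z : Ω → F} (hS : Measurable S)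
    (hZ : Measurable Z) (hSZ : IndepFun S Z P) (hsymm : IdentDistrib Z (-Z) P P) :
    ∫⁻ ω, ‖S ω + Z ω‖ₑ ^ q ∂P ≤ ∫⁻ ω, ‖S ω‖ₑ ^ q ∂P + ∫⁻ ω, ‖Z ω‖ₑ ^ q ∂P := by
  have hSZ' : IndepFun S (-Z) P := hSZ.comp measurable_id measurable_neg
  have hpair : IdentDistrib (fun ω => (S ω, Z ω)) (fun ω => (S ω, (-Z) ω)) P P :=
    (IdentDistrib.refl hS.aemeasurable).prodMk hsymm hSZ hSZ'
  have hm : Measurable fun x : F × F => ‖x.1 + x.2‖ₑ ^ q := by fun_prop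
  have heq : ∫⁻ ω, ‖S ω - Z ω‖ₑ ^ q ∂P = ∫⁻ ω, ‖S ω + Z ω‖ₑ ^ q ∂P := by
    have h := (hpair.comp hm).lintegral_eq
    simp only [Function.comp_def, Pi.neg_apply, ← sub_eq_add_neg] at h
    exact h.symm
  have h2 : 2 * ∫⁻ ω, ‖S ω + Z ω‖ₑ ^ q ∂P ≤
      2 * (∫⁻ ω, ‖S ω‖ₑ ^ q ∂P + ∫⁻ ω, ‖Z ω‖ₑ ^ q ∂P) := by
    rw [two_mul]
    nth_rw 2 [← heq]
    rw [← lintegral_add_left (by fun_prop), ← lintegral_add_left (by fun_prop),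
      ← lintegral_const_mul _ (by fun_prop)]
    exact lintegral_mono fun ω => hF (S ω) (Z ω)
  exact (ENNReal.mul_le_mul_iff_right (by norm_num) (by norm_num)).mp h2

variable [NormedSpace ℝ F] {E : Type*} [MeasurableSpace E] {η : Ω → Measure E} {m : Measure E}

/-- Each summand is symmetric, being a difference of two independent counts with the same law, and
is independent of the others because all the sets are disjoint. Terms are therefore added one at a
time without a constant that grows with their number. -/
lemma IsPoissonRandomMeasure.lintegral_sum_smul_rpow_le (hη : IsPoissonRandomMeasure η m P)
    (hF : ClarksonInequality F q) (hq : 0 < q) (hq2 : q ≤ 2) {ι : Type*} [Fintype ι]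
    (A : ι × Bool → Set E) (hA : ∀ x, MeasurableSet (A x))
    (hd : Pairwise (Function.onFun Disjoint A)) (hmA : ∀ x, m (A x) ≠ ∞)
    (hm : ∀ i, m (A (i, false)) = m (A (i, true))) (c : ι → F) (T : Finset ι) :
    ∫⁻ ω, ‖∑ i ∈ T, ((η ω).real (A (i, true)) - (η ω).real (A (i, false))) • c i‖ₑ ^ q ∂P ≤
      ∑ i ∈ T, 2 * (m (A (i, true)) * ‖c i‖ₑ ^ q) := by
  classical
  have hmeas : ∀ x, Measurable fun ω => (η ω).real (A x) := fun x => hη.measurable_real (hA x)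
  induction T using Finset.induction_on with
  | empty => simp [hq]
  | insert a T ha ih =>
    simp_rw [Finset.sum_insert ha]
    set Z : Ω → F := fun ω => ((η ω).real (A (a, true)) - (η ω).real (A (a, false))) • c a with hZ
    set S : Ω → F := fun ω =>
      ∑ i ∈ T, ((η ω).real (A (i, true)) - (η ω).real (A (i, false))) • c i with hS
    have hZm : Measurable Z := ((hmeas _).sub (hmeas _)).smul_const _
    have hSm : Measurable S :=
      Finset.measurable_fun_sum _ fun i _ => ((hmeas _).sub (hmeas _)).smul_const _
    have hSZ : IndepFun S Z P := by
      have hdis : Disjoint (T ×ˢ (Finset.univ : Finset Bool)) ({a} ×ˢ Finset.univ) := by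
        rw [Finset.disjoint_product]
        exact Or.inl (by simpa using ha)
      have h := (hη.iIndepFun_real A hA hd).indepFun_finset _ _ hdis hmeas
      let φ : ((x : (T ×ˢ (Finset.univ : Finset Bool) : Finset (ι × Bool))) → ℝ) → F := fun v =>
        ∑ i : T, (v ⟨(i, true), by simp⟩ - v ⟨(i, false), by simp⟩) • c i
      let ψ : ((x : ({a} ×ˢ (Finset.univ : Finset Bool) : Finset (ι × Bool))) → ℝ) → F := fun v =>
        (v ⟨(a, true), by simp⟩ - v ⟨(a, false), by simp⟩) • c a
      have hφ : Measurable φ := by fun_prop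
      have hψ : Measurable ψ := by fun_prop
      have h' := h.comp hφ hψ
      have hSφ : S = φ ∘ fun ω (x : (T ×ˢ (Finset.univ : Finset Bool) : Finset (ι × Bool))) =>
          (η ω).real (A x) := by
        funext ω
        simp only [hS, φ, Function.comp_apply]
        exact (Finset.sum_coe_sort T fun i =>
          ((η ω).real (A (i, true)) - (η ω).real (A (i, false))) • c i).symm
      rw [hSφ]
      exact h'
    have hsymm : IdentDistrib Z (-Z) P P := by
      have hid : IdentDistrib (fun ω => (η ω).real (A (a, true)))
          (fun ω => (η ω).real (A (a, false))) P P := by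
        have h := hη.identDistrib (hA (a, false)) (hmA _)
        rw [hm] at h
        exact (hη.identDistrib (hA (a, true)) (hmA _)).trans h.symm
      have hind := hη.indepFun_real (hA (a, true)) (hA (a, false)) (hd (by simp))
      have hpair := hid.prodMk hid.symm hind hind.symm
      have hg : Measurable fun x : ℝ × ℝ => (x.1 - x.2) • c a := by fun_prop
      have h := hpair.comp hg
      have hneg : -Z = (fun x : ℝ × ℝ => (x.1 - x.2) • c a) ∘
          fun ω => ((η ω).real (A (a, false)), (η ω).real (A (a, true))) := by
        funext ω
        simp only [hZ, Pi.neg_apply, Function.comp_apply, ← neg_smul, neg_sub]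
      rw [hneg]
      exact h
    have hZle : ∫⁻ ω, ‖Z ω‖ₑ ^ q ∂P ≤ 2 * (m (A (a, true)) * ‖c a‖ₑ ^ q) := by
      simp only [hZ, enorm_smul, ENNReal.mul_rpow_of_nonneg _ _ hq.le]
      rw [lintegral_mul_const _ (by fun_prop), ← mul_assoc]
      gcongr
      exact hη.lintegral_sub_rpow_le (hA _) (hA _) (hd (by simp)) (hmA _) (hm a) hq hq2
    calc ∫⁻ ω, ‖Z ω + S ω‖ₑ ^ q ∂P = ∫⁻ ω, ‖S ω + Z ω‖ₑ ^ q ∂P := by simp_rw [add_comm]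
      _ ≤ ∫⁻ ω, ‖S ω‖ₑ ^ q ∂P + ∫⁻ ω, ‖Z ω‖ₑ ^ q ∂P :=
        lintegral_enorm_add_rpow_le hF hSm hZm hSZ hsymm
      _ ≤ _ := by
        rw [add_comm]
        exact add_le_add hZle ih

end TypeInequality

/-! ### Integrals of odd functions by simple approximation -/

section PoissonIntegral

variable {Ω E F : Type*} [MeasurableSpace Ω] [MeasurableSpace E] {P : Measure Ω}
  {η : Ω → Measure E} {m : Measure E} [NormedAddCommGroup F]

lemma lintegral_simpleFunc_enorm_rpow (s : SimpleFunc E F) (μ : Measure E) (q : ℝ) :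
    ∫⁻ x, ‖s x‖ₑ ^ q ∂μ = ∑ c ∈ s.range, ‖c‖ₑ ^ q * μ (s ⁻¹' {c}) := by
  rw [← SimpleFunc.map_lintegral (fun c : F => ‖c‖ₑ ^ q) s, ← SimpleFunc.lintegral_eq_lintegral]
  rfl

variable [MeasurableSpace F] [BorelSpace F] [SecondCountableTopology F]

/-- The standard approximation of a measurable function by simple functions. -/
noncomputable def simpleApprox {f : E → F} (hf : Measurable f) (n : ℕ) : SimpleFunc E F :=
  SimpleFunc.approxOn f hf Set.univ 0 (Set.mem_univ _) n

lemma enorm_simpleApprox_le {f : E → F} (hf : Measurable f) (n : ℕ) (x : E) :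
    ‖simpleApprox hf n x‖ₑ ≤ 2 * ‖f x‖ₑ := by
  have h := SimpleFunc.norm_approxOn_zero_le hf (Set.mem_univ (0 : F)) x n
  rw [← two_mul] at h
  calc ‖simpleApprox hf n x‖ₑ = ENNReal.ofReal ‖simpleApprox hf n x‖ := (ofReal_norm _).symm
    _ ≤ ENNReal.ofReal (2 * ‖f x‖) := ENNReal.ofReal_le_ofReal h
    _ = 2 * ‖f x‖ₑ := by
      rw [ENNReal.ofReal_mul (by norm_num), ofReal_norm, ENNReal.ofReal_ofNat]

variable [NormedSpace ℝ F] {q : ℝ} {σ : E → E}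

lemma IsPoissonRandomMeasure.lintegral_simpleFunc_rpow_le [IsProbabilityMeasure P]
    (hη : IsPoissonRandomMeasure η m P)
    (hF : ClarksonInequality F q) (hq : 0 < q) (hq2 : q ≤ 2) (hσ : Measurable σ)
    (hm : m.map σ = m) {B : Set E} (hB : MeasurableSet B) (hBσ : Disjoint B (σ ⁻¹' B))
    (hmB : m B ≠ ∞) (s : SimpleFunc E F) :
    ∫⁻ ω, ‖∑ c ∈ s.range, ((η ω).restrict B).real (s ⁻¹' {c}) • c -
        ∑ c ∈ s.range, (((η ω).map σ).restrict B).real (s ⁻¹' {c}) • c‖ₑ ^ q ∂P ≤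
      2 * ∫⁻ x in B, ‖s x‖ₑ ^ q ∂m := by
  -- For each value of `s`, the level set inside `B` is paired with its reflected copy. Invariance
  -- of `m` gives equal masses, and disjointness of `B` from `σ ⁻¹' B` separates the two families.
  let A : s.range × Bool → Set E := fun x =>
    if x.2 then s ⁻¹' {x.1.1} ∩ B else σ ⁻¹' (s ⁻¹' {x.1.1} ∩ B)
  have hmeas : ∀ c, MeasurableSet (s ⁻¹' {c} ∩ B) := fun c =>
    (s.measurableSet_preimage {c}).inter hB
  have hm' : ∀ c, m (σ ⁻¹' (s ⁻¹' {c} ∩ B)) = m (s ⁻¹' {c} ∩ B) := fun c => by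
    rw [← Measure.map_apply hσ (hmeas c), hm]
  have hfin : ∀ c, m (s ⁻¹' {c} ∩ B) ≠ ∞ := fun c =>
    ne_top_of_le_ne_top hmB (measure_mono Set.inter_subset_right)
  have hlevel : ∀ c d : F, c ≠ d → Disjoint (s ⁻¹' {c} ∩ B) (s ⁻¹' {d} ∩ B) := fun c d hcd =>
    ((Set.disjoint_singleton.mpr hcd).preimage s).mono Set.inter_subset_left Set.inter_subset_left
  have hcross : ∀ c d : F, Disjoint (s ⁻¹' {c} ∩ B) (σ ⁻¹' (s ⁻¹' {d} ∩ B)) := fun c d =>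
    hBσ.mono Set.inter_subset_right (Set.preimage_mono Set.inter_subset_right)
  have h := hη.lintegral_sum_smul_rpow_le hF hq hq2 A
    (by rintro ⟨c, _ | _⟩ <;> simp only [A] <;> [exact hσ (hmeas c); exact hmeas c])
    (by
      rintro ⟨c, _ | _⟩ ⟨d, _ | _⟩ hne
      · exact (hlevel c d fun h => hne (by rw [Subtype.ext h])).preimage σ
      · exact (hcross d c).symm
      · exact hcross c d
      · exact hlevel c d fun h => hne (by rw [Subtype.ext h]))
    (by
      rintro ⟨c, _ | _⟩
      · exact (hm' c).trans_ne (hfin c)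
      · exact hfin c)
    (fun c => hm' c) (fun c => c.1) Finset.univ
  calc _ = ∫⁻ ω, ‖∑ i : s.range, ((η ω).real (A (i, true)) - (η ω).real (A (i, false))) • i.1‖ₑ ^ q
        ∂P := by
        refine lintegral_congr fun ω => ?_
        rw [← Finset.sum_sub_distrib, ← Finset.sum_coe_sort s.range]
        congr 2
        refine Finset.sum_congr rfl fun c _ => ?_
        rw [← sub_smul, measureReal_restrict_apply (s.measurableSet_preimage _),
          measureReal_restrict_apply (s.measurableSet_preimage _),
          map_measureReal_apply hσ (hmeas c)]
        rfl
    _ ≤ ∑ i : s.range, 2 * (m (A (i, true)) * ‖i.1‖ₑ ^ q) := h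
    _ = 2 * ∫⁻ x in B, ‖s x‖ₑ ^ q ∂m := by
        rw [lintegral_simpleFunc_enorm_rpow, Finset.mul_sum, ← Finset.sum_coe_sort s.range]
        refine Finset.sum_congr rfl fun c _ => ?_
        rw [Measure.restrict_apply (s.measurableSet_preimage _), mul_comm (‖c.1‖ₑ ^ q)]
        rfl

variable [CompleteSpace F]

lemma tendsto_simpleApprox_integral {f : E → F} (hf : Measurable f) {μ : Measure E}
    (hfi : Integrable f μ) :
    Tendsto (fun n => ∑ c ∈ (simpleApprox hf n).range,
      μ.real (simpleApprox hf n ⁻¹' {c}) • c) atTop (𝓝 (∫ x, f x ∂μ)) := by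
  have h := tendsto_integral_approxOn_of_measurable_of_range_subset hf hfi Set.univ
    (Set.subset_univ _)
  simp_rw [SimpleFunc.integral_eq] at h
  exact h

lemma IsPoissonRandomMeasure.aestronglyMeasurable_setIntegral (hη : IsPoissonRandomMeasure η m P)
    {f : E → F} (hf : Measurable f) {B : Set E} (hB : MeasurableSet B)
    (hfi : ∀ᵐ ω ∂P, IntegrableOn f B (η ω)) :
    AEStronglyMeasurable (fun ω => ∫ x in B, f x ∂η ω) P := by
  refine aestronglyMeasurable_of_tendsto_ae (u := atTop) (f := fun n ω =>
    ∑ c ∈ (simpleApprox hf n).range,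
      ((η ω).restrict B).real (simpleApprox hf n ⁻¹' {c}) • c) (fun n => ?_) ?_
  · refine Measurable.aestronglyMeasurable (Finset.measurable_fun_sum _ fun c _ => ?_)
    have hmeas := (simpleApprox hf n).measurableSet_preimage {c}
    simp_rw [measureReal_restrict_apply hmeas]
    exact (hη.measurable_real (hmeas.inter hB)).smul_const _
  · filter_upwards [hfi] with ω hω
    exact tendsto_simpleApprox_integral hf hω

/-- The `q`-th moment of the integral of an odd function against a Poisson random measure whose
intensity is invariant under the reflection `σ`. -/
lemma IsPoissonRandomMeasure.lintegral_odd_rpow_le [IsProbabilityMeasure P]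
    (hη : IsPoissonRandomMeasure η m P)
    (hF : ClarksonInequality F q) (hq : 0 < q) (hq2 : q ≤ 2) (hσ : Measurable σ)
    (hm : m.map σ = m) {B : Set E} (hB : MeasurableSet B) (hBσ : Disjoint B (σ ⁻¹' B))
    (hmB : m B ≠ ∞) {f : E → F} (hf : Measurable f) (hodd : ∀ x, f (σ x) = -f x)
    (hfi : ∀ᵐ ω ∂P, IntegrableOn f (B ∪ σ ⁻¹' B) (η ω)) :
    ∫⁻ ω, ‖∫ x in B ∪ σ ⁻¹' B, f x ∂η ω‖ₑ ^ q ∂P ≤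
      2 * 2 ^ q * ∫⁻ x in B, ‖f x‖ₑ ^ q ∂m := by
  -- The simple approximations of `f` need not be odd, so they are used on `B` only. The half `σ ⁻¹'
  -- B` is carried to `B` by `σ`, where oddness of `f` produces the minus sign.
  let S : ℕ → Ω → F := fun n ω => ∑ c ∈ (simpleApprox hf n).range,
      ((η ω).restrict B).real (simpleApprox hf n ⁻¹' {c}) • c -
    ∑ c ∈ (simpleApprox hf n).range,
      (((η ω).map σ).restrict B).real (simpleApprox hf n ⁻¹' {c}) • c
  have hSm : ∀ n, Measurable (S n) := fun n => by
    have hmeas := fun c => (simpleApprox hf n).measurableSet_preimage {c}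
    refine (Finset.measurable_fun_sum _ fun c _ => ?_).sub
      (Finset.measurable_fun_sum _ fun c _ => ?_)
    · simp_rw [measureReal_restrict_apply (hmeas c)]
      exact (hη.measurable_real ((hmeas c).inter hB)).smul_const _
    · simp_rw [measureReal_restrict_apply (hmeas c), map_measureReal_apply hσ ((hmeas c).inter hB)]
      exact (hη.measurable_real (hσ ((hmeas c).inter hB))).smul_const _
  have hlim : ∀ᵐ ω ∂P, Tendsto (fun n => S n ω) atTop (𝓝 (∫ x in B ∪ σ ⁻¹' B, f x ∂η ω)) := by
    filter_upwards [hfi] with ω hω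
    have hω1 : IntegrableOn f B (η ω) := hω.mono_set Set.subset_union_left
    have hω2 : IntegrableOn f (σ ⁻¹' B) (η ω) := hω.mono_set Set.subset_union_right
    have hω3 : IntegrableOn f B ((η ω).map σ) := by
      rw [IntegrableOn, Measure.restrict_map hσ hB,
        integrable_map_measure hf.aestronglyMeasurable hσ.aemeasurable]
      have : f ∘ σ = -f := funext hodd
      rw [this]
      exact hω2.neg
    have h := (tendsto_simpleApprox_integral hf hω1).sub (tendsto_simpleApprox_integral hf hω3)
    rw [setIntegral_map hB hf.aestronglyMeasurable hσ.aemeasurable] at h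
    simp_rw [hodd] at h
    rw [integral_neg, sub_neg_eq_add, ← setIntegral_union hBσ (hσ hB) hω1 hω2] at h
    exact h
  calc ∫⁻ ω, ‖∫ x in B ∪ σ ⁻¹' B, f x ∂η ω‖ₑ ^ q ∂P
      = ∫⁻ ω, liminf (fun n => ‖S n ω‖ₑ ^ q) atTop ∂P := by
        refine lintegral_congr_ae ?_
        filter_upwards [hlim] with ω hω
        exact ((ENNReal.continuous_rpow_const.tendsto _).comp hω.enorm).liminf_eq.symm
    -- Fatou's lemma: almost sure convergence and a uniform bound on the moments of `S n` suffice.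
    _ ≤ liminf (fun n => ∫⁻ ω, ‖S n ω‖ₑ ^ q ∂P) atTop :=
        lintegral_liminf_le fun n => by have := hSm n; fun_prop
    -- The factor `2 ^ q` is the price of dominating the approximations by `2‖f‖`.
    _ ≤ 2 * 2 ^ q * ∫⁻ x in B, ‖f x‖ₑ ^ q ∂m := by
        refine liminf_le_of_le (by isBoundedDefault) fun b hb => ?_
        obtain ⟨n, hn⟩ := hb.exists
        refine hn.trans ((hη.lintegral_simpleFunc_rpow_le hF hq hq2 hσ hm hB hBσ hmB
          (simpleApprox hf n)).trans ?_)
        rw [mul_assoc]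
        gcongr 2 * ?_
        rw [← lintegral_const_mul _ (by fun_prop)]
        refine lintegral_mono fun x => ?_
        rw [← ENNReal.mul_rpow_of_nonneg _ _ hq.le]
        exact ENNReal.rpow_le_rpow (enorm_simpleApprox_le hf n x) hq.le

end PoissonIntegral

/-! ### The Clarkson inequality in `L^p` and `ℓ^p` -/

/-- Apply `r ↦ r^{q/2}` to the parallelogram law: concavity bounds the mean on the left,
subadditivity splits `‖u‖² + ‖v‖²` on the right. -/
lemma norm_add_rpow_add_norm_sub_rpow_le {H : Type*} [NormedAddCommGroup H]
    [InnerProductSpace ℝ H] {q : ℝ} (hq : 0 ≤ q) (hq2 : q ≤ 2) (u v : H) :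
    ‖u + v‖ ^ q + ‖u - v‖ ^ q ≤ 2 * (‖u‖ ^ q + ‖v‖ ^ q) := by
  have hsq : ∀ w : H, ‖w‖ ^ q = (‖w‖ * ‖w‖) ^ (q / 2) := fun w => by
    rw [← sq, ← Real.rpow_natCast, ← Real.rpow_mul (norm_nonneg w)]
    congr 1
    push_cast
    ring
  have hpar := parallelogram_law_with_norm ℝ u v
  have hconc := (Real.concaveOn_rpow (by linarith : 0 ≤ q / 2) (by linarith : q / 2 ≤ 1)).2
    (mul_self_nonneg ‖u + v‖) (mul_self_nonneg ‖u - v‖)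
    (by norm_num : (0 : ℝ) ≤ 1 / 2) (by norm_num : (0 : ℝ) ≤ 1 / 2) (by norm_num)
  have hsub := Real.rpow_add_le_add_rpow (mul_self_nonneg ‖u‖) (mul_self_nonneg ‖v‖)
    (by linarith : 0 ≤ q / 2) (by linarith : q / 2 ≤ 1)
  have hmid : (1 / 2 : ℝ) • (‖u + v‖ * ‖u + v‖) + (1 / 2 : ℝ) • (‖u - v‖ * ‖u - v‖) =
      ‖u‖ * ‖u‖ + ‖v‖ * ‖v‖ := by
    simp only [smul_eq_mul]
    linarith
  rw [hmid] at hconc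
  simp only [smul_eq_mul] at hconc
  rw [hsq (u + v), hsq (u - v), hsq u, hsq v]
  linarith

lemma enorm_rpow_eq_ofReal {G : Type*} [SeminormedAddCommGroup G] {q : ℝ} (hq : 0 ≤ q) (w : G) :
    ‖w‖ₑ ^ q = ENNReal.ofReal (‖w‖ ^ q) := by
  rw [← ofReal_norm, ENNReal.ofReal_rpow_of_nonneg (norm_nonneg w) hq]

lemma clarksonInequality_of_innerProductSpace (H : Type*) [NormedAddCommGroup H]
    [InnerProductSpace ℝ H] {q : ℝ} (hq : 0 ≤ q) (hq2 : q ≤ 2) : ClarksonInequality H q := by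
  intro u v
  simp_rw [enorm_rpow_eq_ofReal hq]
  rw [← ENNReal.ofReal_add (by positivity) (by positivity),
    ← ENNReal.ofReal_add (by positivity) (by positivity), ← ENNReal.ofReal_ofNat,
    ← ENNReal.ofReal_mul (by norm_num)]
  exact ENNReal.ofReal_le_ofReal (norm_add_rpow_add_norm_sub_rpow_le hq hq2 u v)

section

variable {p : ℝ≥0∞} [Fact (1 ≤ p)]

lemma toReal_pos_of_fact (hp : p ≠ ∞) : 0 < p.toReal :=
  ENNReal.toReal_pos (zero_lt_one.trans_le Fact.out).ne' hp

lemma enorm_Lp_rpow {α F : Type*} [MeasurableSpace α] {μ : Measure α} [NormedAddCommGroup F]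
    (hp : p ≠ ∞) (f : Lp F p μ) : ‖f‖ₑ ^ p.toReal = ∫⁻ x, ‖f x‖ₑ ^ p.toReal ∂μ := by
  have hp0 : p ≠ 0 := (zero_lt_one.trans_le Fact.out).ne'
  rw [Lp.enorm_def, eLpNorm_eq_lintegral_rpow_enorm_toReal hp0 hp, ← ENNReal.rpow_mul,
    one_div, inv_mul_cancel₀ (toReal_pos_of_fact hp).ne', ENNReal.rpow_one]

lemma enorm_lp_rpow {ι : Type*} {G : ι → Type*} [∀ i, NormedAddCommGroup (G i)] (hp : p ≠ ∞)
    (a : lp G p) : ‖a‖ₑ ^ p.toReal = ∑' i, ‖a i‖ₑ ^ p.toReal := by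
  have hq := toReal_pos_of_fact hp
  rw [enorm_rpow_eq_ofReal hq.le, lp.norm_rpow_eq_tsum hq a,
    ENNReal.ofReal_tsum_of_nonneg (fun i => by positivity) ((lp.memℓp a).summable hq)]
  exact tsum_congr fun i => (enorm_rpow_eq_ofReal hq.le _).symm

/-- The exponent in the inequality is that of the space, so the `p`-th power of the norm is an
integral and the inequality can be integrated pointwise. The same holds for sums in `ℓ^p` below. -/
lemma ClarksonInequality.Lp {α F : Type*} [MeasurableSpace α] {μ : Measure α}
    [NormedAddCommGroup F] (hp : p ≠ ∞) (hF : ClarksonInequality F p.toReal) :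
    ClarksonInequality (Lp F p μ) p.toReal := by
  intro u v
  have hmeas : ∀ f : MeasureTheory.Lp F p μ, AEMeasurable (fun x => ‖f x‖ₑ ^ p.toReal) μ := fun f =>
    (Lp.aestronglyMeasurable f).enorm.pow_const _
  simp_rw [enorm_Lp_rpow hp]
  rw [← lintegral_add_left' (hmeas _), ← lintegral_add_left' (hmeas _),
    ← lintegral_const_mul'' (r := 2) (f := fun x => ‖u x‖ₑ ^ p.toReal + ‖v x‖ₑ ^ p.toReal)
      ((hmeas u).add (hmeas v))]
  refine lintegral_mono_ae ?_
  filter_upwards [Lp.coeFn_add u v, Lp.coeFn_sub u v] with x h1 h2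
  rw [h1, h2]
  exact hF _ _

lemma ClarksonInequality.lp {ι : Type*} {G : ι → Type*} [∀ i, NormedAddCommGroup (G i)]
    (hp : p ≠ ∞) (hG : ∀ i, ClarksonInequality (G i) p.toReal) :
    ClarksonInequality (lp G p) p.toReal := by
  intro u v
  simp_rw [enorm_lp_rpow hp]
  rw [← ENNReal.tsum_add, ← ENNReal.tsum_add, ← ENNReal.tsum_mul_left]
  exact ENNReal.tsum_le_tsum fun i => hG i _ _

/-- Finitely supported sequences are dense for finite `p`, and those supported in `Fin n` form the
continuous image of a separable product. -/
lemma separableSpace_lp {G : ℕ → Type*} [∀ i, NormedAddCommGroup (G i)]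
    [∀ i, SeparableSpace (G i)] (hp : p ≠ ∞) : SeparableSpace (lp G p) := by
  let T : ℕ → Set (lp G p) := fun n =>
    Set.range fun a : (i : Fin n) → G i => ∑ i : Fin n, lp.single p (i : ℕ) (a i)
  have hT : IsSeparable (⋃ n, T n) := .iUnion fun n => isSeparable_range
    (continuous_finsetSum _ fun i _ =>
      (lp.isometry_single (E := G) (p := p) (i : ℕ)).continuous.comp (continuous_apply i))
  have huniv : Set.univ ⊆ closure (⋃ n, T n) := fun f _ => by
    refine mem_closure_of_tendsto (lp.hasSum_single hp f).tendsto_sum_nat (.of_forall fun n => ?_)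
    refine Set.mem_iUnion.mpr ⟨n, fun i => f i, ?_⟩
    exact Fin.sum_univ_eq_sum_range (fun i => lp.single p i (f i)) n
  exact isSeparable_univ_iff.mp (hT.closure.mono huniv)

end

/-! ### Smooth high-frequency cut-offs -/

/-- The cut-off function as a complex-valued Schwartz function. -/
noncomputable def cutoffSchwartz : 𝓢(ℝ, ℂ) :=
  HasCompactSupport.toSchwartzMap (f := fun x => (cutoff x : ℂ))
    (cutoff.hasCompactSupport.comp_left (g := Complex.ofReal) Complex.ofReal_zero)
    (Complex.ofRealCLM.contDiff.comp cutoff.contDiff)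

lemma cutoffSchwartz_apply (x : ℝ) : cutoffSchwartz x = (cutoff x : ℂ) := rfl

lemma cutoff_eq_one {x : ℝ} (hx : |x| ≤ 1) : cutoff x = 1 :=
  cutoff.one_of_mem_closedBall (by simpa [cutoff] using hx)

lemma cutoff_eq_zero {x : ℝ} (hx : 3 / 2 ≤ |x|) : cutoff x = 0 :=
  cutoff.zero_of_le_dist (by simpa [cutoff] using hx)

/-- The dilated cut-off `x ↦ φ₀(x / R)`. -/
noncomputable def lowPass (R : ℝ) (x : ℝ) : ℂ := cutoff (x / R)

/-- The complement `x ↦ 1 - φ₀(x / R)` of the dilated cut-off. -/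
noncomputable def highPass (R : ℝ) (x : ℝ) : ℂ := 1 - lowPass R x

lemma lowPass_eq_comp (R : ℝ) :
    lowPass R = cutoffSchwartz ∘ (R⁻¹ • ContinuousLinearMap.id ℝ ℝ : ℝ →L[ℝ] ℝ) := by
  funext x
  simp [lowPass, cutoffSchwartz_apply, div_eq_inv_mul]

lemma hasTemperateGrowth_lowPass (R : ℝ) : (lowPass R).HasTemperateGrowth := by
  rw [lowPass_eq_comp]
  exact cutoffSchwartz.hasTemperateGrowth.comp (ContinuousLinearMap.hasTemperateGrowth _)

lemma hasTemperateGrowth_highPass (R : ℝ) : (highPass R).HasTemperateGrowth :=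
  (Function.HasTemperateGrowth.const 1).sub (hasTemperateGrowth_lowPass R)

lemma highPass_eq_zero {R x : ℝ} (hR : 0 < R) (hx : |x| ≤ R) : highPass R x = 0 := by
  rw [highPass, lowPass, cutoff_eq_one, Complex.ofReal_one, sub_self]
  rwa [abs_div, abs_of_pos hR, div_le_one hR]

lemma highPass_eq_one {R x : ℝ} (hR : 0 < R) (hx : 3 / 2 * R ≤ |x|) : highPass R x = 1 := by
  rw [highPass, lowPass, cutoff_eq_zero, Complex.ofReal_zero, sub_zero]
  rwa [abs_div, abs_of_pos hR, le_div_iff₀ hR]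

/-- Dilating by `R⁻¹ ≤ 1` does not increase derivatives, so the bound is uniform in `R ≥ 1`. -/
lemma norm_iteratedFDeriv_highPass_le (i : ℕ) {R : ℝ} (hR : 1 ≤ R) (x : ℝ) :
    ‖iteratedFDeriv ℝ i (highPass R) x‖ ≤ 1 + SchwartzMap.seminorm ℝ 0 i cutoffSchwartz := by
  have hlow : ContDiff ℝ i (lowPass R) :=
    (hasTemperateGrowth_lowPass R).1.of_le (by exact_mod_cast le_top)
  have h1 : ‖iteratedFDeriv ℝ i (fun _ : ℝ => (1 : ℂ)) x‖ ≤ 1 := by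
    rcases eq_or_ne i 0 with rfl | hi
    · simp
    · rw [iteratedFDeriv_const_of_ne hi]
      simp
  have h2 : ‖iteratedFDeriv ℝ i (lowPass R) x‖ ≤ SchwartzMap.seminorm ℝ 0 i cutoffSchwartz := by
    rw [lowPass_eq_comp, ContinuousLinearMap.iteratedFDeriv_comp_right _
      (cutoffSchwartz.smooth i) x le_rfl]
    refine (ContinuousMultilinearMap.norm_compContinuousLinearMap_le _ _).trans ?_
    have hnorm : ‖(R⁻¹ • ContinuousLinearMap.id ℝ ℝ : ℝ →L[ℝ] ℝ)‖ ≤ 1 := by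
      rw [norm_smul, ContinuousLinearMap.norm_id, mul_one, Real.norm_eq_abs,
        abs_of_pos (by positivity)]
      exact inv_le_one_of_one_le₀ hR
    refine (mul_le_of_le_one_right (norm_nonneg _)
      (Finset.prod_le_one (fun _ _ => norm_nonneg _) fun _ _ => hnorm)).trans ?_
    exact cutoffSchwartz.norm_iteratedFDeriv_le_seminorm ℝ i _
  have h3 : iteratedFDeriv ℝ i (highPass R) x =
      iteratedFDeriv ℝ i (fun _ : ℝ => (1 : ℂ)) x - iteratedFDeriv ℝ i (lowPass R) x :=
    fun_iteratedFDeriv_sub_apply contDiffAt_const hlow.contDiffAt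
  rw [h3]
  exact (norm_sub_le _ _).trans (add_le_add h1 h2)

/-- Multiplication of a Schwartz function by the high-frequency cut-off at scale `R`. -/
noncomputable def highFreq (R : ℝ) (ψ : 𝓢(ℝ, ℂ)) : 𝓢(ℝ, ℂ) :=
  SchwartzMap.smulLeftCLM ℂ (highPass R) ψ

/-- The product vanishes for `|x| < R`. Elsewhere `R ^ M ≤ |x| ^ M`, and the extra power of `|x|` is
absorbed by the rapid decay of `ψ`. -/
lemma seminorm_highFreq_le (ψ : 𝓢(ℝ, ℂ)) (k n M : ℕ) :
    ∃ C : ℝ, 0 ≤ C ∧ ∀ R : ℝ, 1 ≤ R →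
      SchwartzMap.seminorm ℂ k n (highFreq R ψ) ≤ C / R ^ M := by
  refine ⟨∑ i ∈ Finset.range (n + 1), (n.choose i : ℝ) *
    (1 + SchwartzMap.seminorm ℝ 0 i cutoffSchwartz) * SchwartzMap.seminorm ℝ (k + M) (n - i) ψ,
    by positivity, fun R hR => ?_⟩
  have hR0 : 0 < R := by linarith
  refine SchwartzMap.seminorm_le_bound ℂ k n _ (by positivity) fun x => ?_
  have hcoe : ⇑(highFreq R ψ) = fun y => highPass R y * ψ y := by
    rw [highFreq, SchwartzMap.smulLeftCLM_apply (hasTemperateGrowth_highPass R)]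
    rfl
  rw [hcoe]
  rcases lt_or_ge |x| R with hx | hx
  · have h0 : (fun y => highPass R y * ψ y) =ᶠ[𝓝 x] fun _ => 0 := by
      filter_upwards [(continuous_abs.tendsto x).eventually (gt_mem_nhds hx)] with y hy
      rw [highPass_eq_zero hR0 hy.le, zero_mul]
    rw [(Filter.EventuallyEq.iteratedFDeriv ℝ h0 n).eq_of_nhds]
    have hz : iteratedFDeriv ℝ n (fun _ : ℝ => (0 : ℂ)) x = 0 := by simp
    rw [hz, norm_zero, mul_zero]
    positivity
  · have hprod := norm_iteratedFDeriv_mul_le (n := n) (hasTemperateGrowth_highPass R).1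
      (ψ.smooth ⊤) x
      (by exact_mod_cast le_top)
    rw [le_div_iff₀ (by positivity)]
    calc ‖x‖ ^ k * ‖iteratedFDeriv ℝ n (fun y => highPass R y * ψ y) x‖ * R ^ M
        ≤ ‖x‖ ^ k * (∑ i ∈ Finset.range (n + 1), (n.choose i : ℝ) *
            ‖iteratedFDeriv ℝ i (highPass R) x‖ * ‖iteratedFDeriv ℝ (n - i) ψ x‖) * ‖x‖ ^ M := by
          gcongr
          exact hx
      _ = ∑ i ∈ Finset.range (n + 1), (n.choose i : ℝ) * ‖iteratedFDeriv ℝ i (highPass R) x‖ *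
            (‖x‖ ^ (k + M) * ‖iteratedFDeriv ℝ (n - i) ψ x‖) := by
          rw [Finset.mul_sum, Finset.sum_mul]
          refine Finset.sum_congr rfl fun i _ => ?_
          rw [pow_add]
          ring
      _ ≤ _ := by
          refine Finset.sum_le_sum fun i _ => ?_
          gcongr
          · exact norm_iteratedFDeriv_highPass_le i hR x
          · exact ψ.le_seminorm ℝ (k + M) (n - i) x

lemma norm_clm_highFreq_le {G : Type*} [NormedAddCommGroup G] [NormedSpace ℂ G]
    (T : 𝓢(ℝ, ℂ) →L[ℂ] G) (ψ : 𝓢(ℝ, ℂ)) (M : ℕ) :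
    ∃ C : ℝ, 0 ≤ C ∧ ∀ R : ℝ, 1 ≤ R → ‖T (highFreq R ψ)‖ ≤ C / R ^ M := by
  obtain ⟨t, K, -, hK⟩ := Seminorm.bound_of_continuous (schwartz_withSeminorms ℂ ℝ ℂ)
    ((normSeminorm ℂ G).comp (T : 𝓢(ℝ, ℂ) →ₗ[ℂ] G)) (T.continuous.norm)
  choose C hC0 hC using fun x : ℕ × ℕ => seminorm_highFreq_le ψ x.1 x.2 M
  refine ⟨K * ∑ x ∈ t, C x, mul_nonneg K.2 (Finset.sum_nonneg fun x _ => hC0 x), fun R hR => ?_⟩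
  calc ‖T (highFreq R ψ)‖ ≤ K * (t.sup (schwartzSeminormFamily ℂ ℝ ℂ)) (highFreq R ψ) :=
        hK (highFreq R ψ)
    _ ≤ K * ∑ x ∈ t, schwartzSeminormFamily ℂ ℝ ℂ x (highFreq R ψ) := by
        gcongr
        have h := Seminorm.finset_sup_le_sum (schwartzSeminormFamily ℂ ℝ ℂ) t (highFreq R ψ)
        simpa using h
    _ ≤ K * ∑ x ∈ t, C x / R ^ M := by
        gcongr with x
        exact hC x R hR
    _ = K * (∑ x ∈ t, C x) / R ^ M := by
        rw [← Finset.sum_div, mul_div_assoc]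

section

open FourierTransform

/-! ### Test functions act continuously on Besov spaces -/

lemma dyadic_zero_ofReal (x : ℝ) : (dyadic 0 x : ℂ) = lowPass 1 x := by
  simp [dyadic, lowPass]

lemma dyadic_succ_ofReal (j : ℕ) (x : ℝ) :
    (dyadic (j + 1) x : ℂ) = lowPass (2 ^ (j + 1)) x - lowPass (2 ^ j) x := by
  simp [dyadic, lowPass]

lemma hasTemperateGrowth_dyadic (j : ℕ) :
    (fun x => (dyadic j x : ℂ)).HasTemperateGrowth := by
  rcases j with _ | j
  · simp_rw [dyadic_zero_ofReal]
    exact hasTemperateGrowth_lowPass 1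
  · simp_rw [dyadic_succ_ofReal]
    exact (hasTemperateGrowth_lowPass _).sub (hasTemperateGrowth_lowPass _)

lemma sum_dyadic_ofReal (J : ℕ) (x : ℝ) :
    ∑ j ∈ Finset.range (J + 1), (dyadic j x : ℂ) = lowPass (2 ^ J) x := by
  induction J with
  | zero => simp [dyadic_zero_ofReal]
  | succ J ih => rw [Finset.sum_range_succ, ih, dyadic_succ_ofReal]; ring

/-- `φ_{j+2}` vanishes for `|x| ≤ 2^{j+1}`, while the high-pass at scale `2^j` is already one for
`|x| ≥ (3/2) 2^j`. The shift by two leaves this room. -/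
lemma dyadic_mul_highPass (j : ℕ) (x : ℝ) :
    (dyadic (j + 2) x : ℂ) * highPass (2 ^ j) x = dyadic (j + 2) x := by
  have hj : (0 : ℝ) < 2 ^ j := by positivity
  rcases le_total |x| (2 ^ (j + 1)) with hx | hx
  · have h1 : highPass (2 ^ (j + 1)) x = 0 := highPass_eq_zero (by positivity) hx
    have h2 : highPass (2 ^ (j + 2)) x = 0 :=
      highPass_eq_zero (by positivity) (hx.trans
        (pow_le_pow_right₀ (by norm_num) (Nat.le_succ _)))
    rw [highPass, sub_eq_zero] at h1 h2
    rw [dyadic_succ_ofReal, ← h1, ← h2, sub_self, zero_mul]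
  · rw [highPass_eq_one hj (le_trans (by rw [pow_succ]; linarith) hx), mul_one]

lemma block_apply (j : ℕ) (f : 𝓢'(ℝ, ℂ)) (φ : 𝓢(ℝ, ℂ)) :
    block j f φ = f (𝓕 (SchwartzMap.smulLeftCLM ℂ (fun x => (dyadic j x : ℂ)) (𝓕⁻ φ))) := rfl

/-- A Schwartz function whose `j`-th Littlewood-Paley block is that of `φ`, and which is small
for large `j`. -/
noncomputable def highFreqPart (φ : 𝓢(ℝ, ℂ)) : ℕ → 𝓢(ℝ, ℂ)
  | 0 => φ
  | 1 => φ
  | j + 2 => 𝓕 (highFreq (2 ^ j) (𝓕⁻ φ))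

lemma block_highFreqPart (j : ℕ) (f : 𝓢'(ℝ, ℂ)) (φ : 𝓢(ℝ, ℂ)) :
    block j f (highFreqPart φ j) = block j f φ := by
  match j with
  | 0 => rfl
  | 1 => rfl
  | j + 2 =>
    rw [block_apply, block_apply, highFreqPart, fourierInv_fourier_eq, highFreq,
      SchwartzMap.smulLeftCLM_smulLeftCLM_apply (hasTemperateGrowth_dyadic _)
      (hasTemperateGrowth_highPass _)]
    congr 4
    funext x
    exact dyadic_mul_highPass j x

lemma norm_clm_highFreqPart_le {G : Type*} [NormedAddCommGroup G] [NormedSpace ℂ G]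
    (T : 𝓢(ℝ, ℂ) →L[ℂ] G) (φ : 𝓢(ℝ, ℂ)) (M : ℕ) :
    ∃ C : ℝ, 0 ≤ C ∧ ∀ j, ‖T (highFreqPart φ j)‖ ≤ C / (2 ^ j) ^ M := by
  obtain ⟨C, hC0, hC⟩ := norm_clm_highFreq_le (T ∘L fourierCLM ℂ 𝓢(ℝ, ℂ)) (𝓕⁻ φ) M
  -- `4 ^ M` compensates for the index shift by two, and `‖T φ‖` covers `j = 0, 1`, where there is
  -- no cut-off.
  refine ⟨(C + ‖T φ‖) * 4 ^ M, by positivity, fun j => ?_⟩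
  have h4 : (1 : ℝ) ≤ 4 ^ M := one_le_pow₀ (by norm_num)
  match j with
  | 0 =>
    rw [pow_zero, one_pow, div_one]
    exact (le_add_of_nonneg_left hC0).trans (le_mul_of_one_le_right (by positivity) h4)
  | 1 =>
    rw [pow_one, le_div_iff₀ (by positivity)]
    have h2 : (2 : ℝ) ^ M ≤ 4 ^ M := pow_le_pow_left₀ (by norm_num) (by norm_num) M
    exact mul_le_mul (le_add_of_nonneg_left hC0) h2 (by positivity) (by positivity)
  | j + 2 =>
    have h := hC (2 ^ j) (one_le_pow₀ (by norm_num))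
    have hpow : ((2 : ℝ) ^ (j + 2)) ^ M = (2 ^ j) ^ M * 4 ^ M := by
      rw [pow_add, mul_pow]
      norm_num
    rw [hpow, mul_div_mul_right _ _ (by positivity)]
    refine h.trans ?_
    gcongr
    exact le_add_of_nonneg_right (norm_nonneg _)

/-- The partial sums telescope to a low-pass at scale `2^J`; the remainder tests `f` on a
high-frequency part, which tends to zero. -/
lemma tendsto_sum_block (f : 𝓢'(ℝ, ℂ)) (φ : 𝓢(ℝ, ℂ)) :
    Tendsto (fun J => ∑ j ∈ Finset.range (J + 1), block j f φ) atTop (𝓝 (f φ)) := by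
  have hsum : ∀ J, ∑ j ∈ Finset.range (J + 1), block j f φ =
      f φ - f (𝓕 (highFreq (2 ^ J) (𝓕⁻ φ))) := fun J => by
    simp_rw [block_apply]
    rw [← map_sum, ← map_sub]
    congr 1
    rw [← fourierCLM_apply (R := ℂ)]
    simp_rw [← fourierCLM_apply (R := ℂ)]
    rw [← map_sum]
    have hφ : φ = fourierCLM ℂ 𝓢(ℝ, ℂ) (𝓕⁻ φ) := by
      rw [fourierCLM_apply, fourier_fourierInv_eq]
    nth_rw 2 [hφ]
    rw [← map_sub]
    congr 1
    ext x
    rw [highFreq, sub_apply, sum_apply,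
      SchwartzMap.smulLeftCLM_apply_apply (hasTemperateGrowth_highPass _)]
    simp_rw [SchwartzMap.smulLeftCLM_apply_apply (hasTemperateGrowth_dyadic _)]
    rw [← Finset.sum_smul, sum_dyadic_ofReal, highPass, sub_smul, one_smul, sub_sub_cancel]
  simp_rw [hsum]
  have hzero : Tendsto (fun J : ℕ => f (𝓕 (highFreq (2 ^ J) (𝓕⁻ φ)))) atTop (𝓝 0) := by
    obtain ⟨C, hC0, hC⟩ := norm_clm_highFreq_le
      ((f : 𝓢(ℝ, ℂ) →L[ℂ] ℂ) ∘L fourierCLM ℂ 𝓢(ℝ, ℂ)) (𝓕⁻ φ) 1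
    refine squeeze_zero_norm (fun J => hC (2 ^ J) (one_le_pow₀ (by norm_num))) ?_
    simp_rw [pow_one]
    exact tendsto_const_nhds.div_atTop (tendsto_pow_atTop_atTop_of_one_lt (by norm_num))
  simpa using tendsto_const_nhds.sub hzero

/-- Hölder's inequality with the conjugate exponent `(1 - p⁻¹)⁻¹`, combined with the decay of the
high-frequency parts of `φ` in that `L^q`. -/
lemma norm_toTemperedDistribution_highFreqPart_le {p : ℝ≥0∞} [Fact (1 ≤ p)] (φ : 𝓢(ℝ, ℂ))
    (M : ℕ) : ∃ C : ℝ, 0 ≤ C ∧ ∀ (b : Lp ℂ p (volume : Measure ℝ)) (j : ℕ),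
      ‖Lp.toTemperedDistribution b (highFreqPart φ j)‖ ≤ C / (2 ^ j) ^ M * ‖b‖ := by
  have : Fact (1 ≤ (1 - p⁻¹)⁻¹) := by simp [fact_iff]
  have hpq : ENNReal.HolderConjugate p (1 - p⁻¹)⁻¹ :=
    ENNReal.HolderConjugate.inv_one_sub_inv' Fact.out
  let B := (ContinuousLinearMap.lsmul ℂ ℂ : ℂ →L[ℂ] ℂ →L[ℂ] ℂ).flip.lpPairing
    (volume : Measure ℝ) p (1 - p⁻¹)⁻¹
  obtain ⟨C, hC0, hC⟩ := norm_clm_highFreqPart_le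
    (SchwartzMap.toLpCLM ℂ ℂ (1 - p⁻¹)⁻¹ (volume : Measure ℝ)) φ M
  refine ⟨‖B‖ * C, by positivity, fun b j => ?_⟩
  calc ‖Lp.toTemperedDistribution b (highFreqPart φ j)‖
      = ‖B b (SchwartzMap.toLpCLM ℂ ℂ (1 - p⁻¹)⁻¹ (volume : Measure ℝ) (highFreqPart φ j))‖ := rfl
    _ ≤ ‖B‖ * ‖b‖ * ‖SchwartzMap.toLpCLM ℂ ℂ (1 - p⁻¹)⁻¹ (volume : Measure ℝ)
          (highFreqPart φ j)‖ := B.le_opNorm₂ _ _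
    _ ≤ ‖B‖ * ‖b‖ * (C / (2 ^ j) ^ M) := by
        gcongr
        exact hC j
    _ = ‖B‖ * C / (2 ^ j) ^ M * ‖b‖ := by ring

/-- A Schwartz function is a bounded functional for the `B^s_{p,p}` norm. -/
lemma exists_norm_apply_le_of_hasBlocks {p : ℝ≥0∞} [Fact (1 ≤ p)] (s : ℝ) (φ : 𝓢(ℝ, ℂ)) :
    ∃ C : ℝ, 0 ≤ C ∧ ∀ (f : 𝓢'(ℝ, ℂ)) (a : SeqLp p), HasBlocks s f a → ‖f φ‖ ≤ C * ‖a‖ := by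
  -- This order of decay beats the weight: `2^{jM} 2^{js} ≥ 2^j`, so the blocks tested on `φ` are
  -- summable, with the geometric sum giving the factor 2.
  obtain ⟨M, hM⟩ := exists_nat_ge (1 - s)
  obtain ⟨C, hC0, hC⟩ := norm_toTemperedDistribution_highFreqPart_le (p := p) φ M
  refine ⟨2 * C, by positivity, fun f a ha => ?_⟩
  have hblock : ∀ j, ‖block j f φ‖ ≤ C * ‖a‖ * (1 / 2) ^ j := fun j => by
    have h2 : (0 : ℝ) < 2 ^ ((j : ℝ) * s) := Real.rpow_pos_of_pos (by norm_num) _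
    have h1 : (((2 : ℝ) ^ ((j : ℝ) * s) : ℝ) : ℂ) * block j f (highFreqPart φ j) =
        Lp.toTemperedDistribution (a j) (highFreqPart φ j) := by
      rw [← ha j]
      rfl
    have hnorm : (2 : ℝ) ^ ((j : ℝ) * s) * ‖block j f φ‖ ≤ C / (2 ^ j) ^ M * ‖a‖ := by
      rw [← block_highFreqPart, ← Complex.norm_of_nonneg h2.le, ← norm_mul, h1]
      refine (hC (a j) j).trans ?_
      gcongr
      exact lp.norm_apply_le_norm (zero_lt_one.trans_le Fact.out).ne' a j
    have hexp : ((2 : ℝ) ^ j) ^ M * 2 ^ ((j : ℝ) * s) ≥ 2 ^ j := by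
      rw [← pow_mul, ← Real.rpow_natCast, ← Real.rpow_add (by norm_num), ← Real.rpow_natCast 2 j]
      refine Real.rpow_le_rpow_of_exponent_le (by norm_num) ?_
      push_cast
      nlinarith [(Nat.cast_nonneg j : (0 : ℝ) ≤ j)]
    calc ‖block j f φ‖ = (2 : ℝ) ^ ((j : ℝ) * s) * ‖block j f φ‖ / 2 ^ ((j : ℝ) * s) := by
          rw [mul_div_cancel_left₀ _ h2.ne']
      _ ≤ C / (2 ^ j) ^ M * ‖a‖ / 2 ^ ((j : ℝ) * s) := by gcongr
      _ = C * ‖a‖ / ((2 ^ j) ^ M * 2 ^ ((j : ℝ) * s)) := by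
          field_simp
      _ ≤ C * ‖a‖ / 2 ^ j := by gcongr
      _ = C * ‖a‖ * (1 / 2) ^ j := by rw [div_pow, one_pow, mul_one_div]
  refine le_of_tendsto (tendsto_sum_block f φ).norm (.of_forall fun J => ?_)
  calc ‖∑ j ∈ Finset.range (J + 1), block j f φ‖
      ≤ ∑ j ∈ Finset.range (J + 1), C * ‖a‖ * (1 / 2) ^ j := norm_sum_le_of_le _ fun j _ => hblock j
    _ ≤ C * ‖a‖ * 2 := by
        rw [← Finset.mul_sum]
        gcongr
        exact (summable_geometric_two.sum_le_tsum _ fun _ _ => by positivity).trans_eq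
          tsum_geometric_two
    _ = 2 * C * ‖a‖ := by ring

/-- Every test function on `(0,1)` belongs to the dual of the Besov space. -/
lemma exists_continuousLinearMap_apply_eq {p : ℝ≥0∞} [Fact (1 ≤ p)] (s : ℝ)
    (φ : 𝓓(openUnitInterval, ℝ)) :
    ∃ ℓ : Besov s p →L[ℝ] ℝ, ∀ x, ℓ x = x.toDistribution φ := by
  obtain ⟨C, hC0, hC⟩ := exists_norm_apply_le_of_hasBlocks (p := p) s (toSchwartz φ)
  let L : Besov s p →ₗ[ℝ] ℝ :=
    { toFun := fun x => x.toDistribution φ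
      map_add' := fun x y => by rw [map_add]; rfl
      map_smul' := fun c x => by rw [map_smul]; rfl }
  refine ⟨L.mkContinuous C fun x => ?_, fun x => rfl⟩
  rw [Besov.norm_def, ← smul_eq_mul, ← Real.sInf_smul_of_nonneg hC0]
  refine le_csInf (x.extensionNorms_nonempty.image _) ?_
  rintro _ ⟨r, ⟨f, a, hf, ha, rfl⟩, rfl⟩
  have h := hC f a ha
  rw [hf φ, Complex.norm_real] at h
  exact h

end

/-! ### A complete space of primitives mapping to the Besov space -/

section Primitive

variable {p : ℝ≥0∞} [Fact (1 ≤ p)]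

/-- The complexification of a real `L^p` function. -/
noncomputable def complexifyLp : Lp ℝ p (volume : Measure ℝ) →L[ℝ] Lp ℂ p (volume : Measure ℝ) :=
  Complex.ofRealCLM.compLpL p volume

lemma coeFn_complexifyLp (g : Lp ℝ p (volume : Measure ℝ)) :
    ∀ᵐ x, complexifyLp g x = (g x : ℂ) :=
  Complex.ofRealCLM.coeFn_compLp g

/-- The distributional derivative on the line of a real `L^p` function. -/
noncomputable def derivLp (g : Lp ℝ p (volume : Measure ℝ)) : 𝓢'(ℝ, ℂ) :=
  TemperedDistribution.derivCLM ℂ (Lp.toTemperedDistribution (complexifyLp g))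

lemma derivLp_apply (g : Lp ℝ p (volume : Measure ℝ)) (φ : 𝓢(ℝ, ℂ)) :
    derivLp g φ = -∫ x, deriv φ x * (g x : ℂ) := by
  rw [derivLp, TemperedDistribution.derivCLM_apply_apply, Lp.toTemperedDistribution_apply,
    ← integral_neg]
  refine integral_congr_ae ?_
  filter_upwards [coeFn_complexifyLp g] with x hx
  rw [hx]
  simp

/-- The distributional derivative on `(0,1)` of a real `L^p` function. -/
noncomputable def restrictedDeriv (g : Lp ℝ p (volume : Measure ℝ)) : 𝓓'(openUnitInterval, ℝ) :=
  Distribution.lineDerivCLM (1 : ℝ)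
    (TestFunction.integralAgainstBilinCLM (ContinuousLinearMap.mul ℝ ℝ) volume g :
      𝓓(openUnitInterval, ℝ) →L[ℝ] ℝ)

lemma restrictedDeriv_apply (g : Lp ℝ p (volume : Measure ℝ)) (φ : 𝓓(openUnitInterval, ℝ)) :
    restrictedDeriv g φ = -∫ x, deriv φ x * g x := by
  have hg : LocallyIntegrableOn g (openUnitInterval : Set ℝ) volume :=
    (((Lp.memLp g).locallyIntegrable Fact.out).locallyIntegrableOn _)
  have h : restrictedDeriv g φ = -∫ x, (TestFunction.lineDerivCLM ℝ (1 : ℝ) φ :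
      𝓓(openUnitInterval, ℝ)) x * g x := by
    have h' : restrictedDeriv g φ = -TestFunction.integralAgainstBilinCLM
        (ContinuousLinearMap.mul ℝ ℝ) volume g (TestFunction.lineDerivCLM ℝ (1 : ℝ) φ :
          𝓓(openUnitInterval, ℝ)) := rfl
    rw [h', TestFunction.integralAgainstBilinCLM_eq_integral hg]
    rfl
  rw [h]
  congr 2

lemma isExtension_derivLp (g : Lp ℝ p (volume : Measure ℝ)) :
    IsExtension (derivLp g) (restrictedDeriv g) := by
  intro φ
  rw [derivLp_apply, restrictedDeriv_apply, Complex.ofReal_neg, ← integral_complex_ofReal]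
  congr 2
  funext x
  rw [Complex.ofReal_mul]
  congr 1
  have h : HasDerivAt (fun y => (φ y : ℂ)) ((deriv φ x : ℝ) : ℂ) x :=
    (φ.contDiff.differentiable (by simp) x).hasDerivAt.ofReal_comp
  exact h.deriv

lemma derivLp_add (g h : Lp ℝ p (volume : Measure ℝ)) :
    derivLp (g + h) = derivLp g + derivLp h := by
  rw [derivLp, map_add, ← Lp.toTemperedDistributionCLM_apply, map_add, map_add]
  rfl

lemma derivLp_smul (c : ℝ) (g : Lp ℝ p (volume : Measure ℝ)) :
    derivLp (c • g) = (c : ℂ) • derivLp g := by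
  have h : complexifyLp (c • g) = (c : ℂ) • complexifyLp g := by
    rw [map_smul]
    rfl
  rw [derivLp, h, ← Lp.toTemperedDistributionCLM_apply, map_smul, map_smul]
  rfl

/-- The pairs of a real `L^p` function and of the weighted Littlewood-Paley blocks of its
derivative. -/
noncomputable def primitiveSpace (s : ℝ) (p : ℝ≥0∞) [Fact (1 ≤ p)] :
    Submodule ℝ (Lp ℝ p (volume : Measure ℝ) × SeqLp p) where
  carrier := {v | HasBlocks s (derivLp v.1) v.2}
  zero_mem' := by
    have h : derivLp (0 : Lp ℝ p (volume : Measure ℝ)) = 0 := by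
      rw [derivLp, map_zero, ← Lp.toTemperedDistributionCLM_apply, map_zero, map_zero]
    change HasBlocks s (derivLp 0) 0
    rw [h]
    exact hasBlocks_zero
  add_mem' := by
    intro u v hu hv
    change HasBlocks s (derivLp (u.1 + v.1)) (u.2 + v.2)
    rw [derivLp_add]
    exact HasBlocks.add hu hv
  smul_mem' := by
    intro c v hv
    change HasBlocks s (derivLp (c • v.1)) ((c : ℂ) • v.2)
    rw [derivLp_smul]
    exact HasBlocks.smul hv (c : ℂ)

variable {s : ℝ}

/-- For each `j` both sides of the block identity are continuous into tempered distributions.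
Keeping `g` in the pair is what makes the left side continuous for the norm. -/
lemma isClosed_primitiveSpace (s : ℝ) (p : ℝ≥0∞) [Fact (1 ≤ p)] :
    IsClosed (primitiveSpace s p : Set (Lp ℝ p (volume : Measure ℝ) × SeqLp p)) := by
  have hset : (primitiveSpace s p : Set (Lp ℝ p (volume : Measure ℝ) × SeqLp p)) =
      ⋂ j : ℕ, {v | (((2 : ℝ) ^ ((j : ℝ) * s) : ℝ) : ℂ) • block j (derivLp v.1) =
        Lp.toTemperedDistribution (v.2 j)} := by
    ext v
    simp only [Set.mem_iInter]
    rfl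
  rw [hset]
  refine isClosed_iInter fun j => isClosed_eq ?_ ?_
  · have h1 : Continuous fun g : Lp ℝ p (volume : Measure ℝ) => derivLp g :=
      (TemperedDistribution.derivCLM ℂ).continuous.comp
        ((Lp.toTemperedDistributionCLM ℂ (volume : Measure ℝ) p).continuous.comp
          complexifyLp.continuous)
    have h2 : Continuous fun v : Lp ℝ p (volume : Measure ℝ) × SeqLp p => block j (derivLp v.1) :=
      (block j).continuous.comp (h1.comp continuous_fst)
    exact h2.const_smul (((2 : ℝ) ^ ((j : ℝ) * s) : ℝ) : ℂ)
  · have h2 : Continuous fun a : SeqLp p => a j :=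
      (lp.lipschitzWith_one_eval (E := fun _ : ℕ => Lp ℂ p (volume : Measure ℝ)) p j).continuous
    exact (Lp.toTemperedDistributionCLM ℂ (volume : Measure ℝ) p).continuous.comp
      (h2.comp continuous_snd)

instance : CompleteSpace (primitiveSpace s p) :=
  (isClosed_primitiveSpace s p).completeSpace_coe

instance [Fact (p ≠ ∞)] : SecondCountableTopology (primitiveSpace s p) := by
  have : SeparableSpace (SeqLp p) := separableSpace_lp Fact.out
  have : SecondCountableTopology (SeqLp p) := UniformSpace.secondCountable_of_separable _
  infer_instance

lemma restrictedDeriv_add (g h : Lp ℝ p (volume : Measure ℝ)) :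
    restrictedDeriv (g + h) = restrictedDeriv g + restrictedDeriv h := by
  ext φ
  have h1 := isExtension_derivLp (g + h) φ
  have h2 := (isExtension_derivLp g).add (isExtension_derivLp h) φ
  rw [derivLp_add, h2] at h1
  exact (Complex.ofReal_injective h1).symm

lemma restrictedDeriv_smul (c : ℝ) (g : Lp ℝ p (volume : Measure ℝ)) :
    restrictedDeriv (c • g) = c • restrictedDeriv g := by
  ext φ
  have h1 := isExtension_derivLp (c • g) φ
  have h2 := (isExtension_derivLp g).smul c φ
  rw [derivLp_smul, h2] at h1
  exact (Complex.ofReal_injective h1).symm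

/-- The derivative on `(0,1)` of a primitive, as an element of the Besov space. -/
noncomputable def toBesovFun (v : primitiveSpace s p) : Besov s p :=
  (⟨restrictedDeriv v.1.1, derivLp v.1.1, v.1.2, isExtension_derivLp v.1.1, v.2⟩ :
    besovSubmodule s p)

lemma toDistribution_injective :
    Function.Injective (Besov.toDistribution : Besov s p → 𝓓'(openUnitInterval, ℝ)) :=
  Subtype.val_injective

lemma norm_toBesovFun_le (v : primitiveSpace s p) : ‖toBesovFun v‖ ≤ ‖v‖ :=
  (Besov.norm_le_of_mem ⟨derivLp v.1.1, v.1.2, isExtension_derivLp v.1.1, v.2, rfl⟩).trans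
    (norm_snd_le v.1)

/-- The derivative on `(0,1)`, from primitives to the Besov space. -/
noncomputable def toBesov (s : ℝ) (p : ℝ≥0∞) [Fact (1 ≤ p)] :
    primitiveSpace s p →L[ℝ] Besov s p :=
  LinearMap.mkContinuous
    { toFun := toBesovFun
      map_add' := fun u v => toDistribution_injective (by
        rw [map_add]
        exact restrictedDeriv_add u.1.1 v.1.1)
      map_smul' := fun c v => toDistribution_injective (by
        rw [map_smul]
        exact restrictedDeriv_smul c v.1.1) }
    1 fun v => (norm_toBesovFun_le v).trans_eq (one_mul _).symm

lemma toDistribution_toBesov (v : primitiveSpace s p) :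
    (toBesov s p v).toDistribution = restrictedDeriv v.1.1 := rfl

end Primitive

section

open FourierTransform

/-! ### Littlewood-Paley blocks of a Dirac mass -/

lemma hasCompactSupport_lowPass {R : ℝ} (hR : 0 < R) : HasCompactSupport (lowPass R) := by
  refine HasCompactSupport.intro (isCompact_Icc (a := -(3 / 2 * R)) (b := 3 / 2 * R)) fun x hx => ?_
  rw [lowPass, cutoff_eq_zero, Complex.ofReal_zero]
  rw [abs_div, abs_of_pos hR, le_div_iff₀ hR]
  by_contra! h
  exact hx (abs_le.1 h.le)

/-- The cut-off at scale `2^n` as a Schwartz function. -/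
noncomputable def lowPassSchwartz (n : ℕ) : 𝓢(ℝ, ℂ) :=
  HasCompactSupport.toSchwartzMap (f := lowPass (2 ^ n)) (hasCompactSupport_lowPass (by positivity))
    (hasTemperateGrowth_lowPass _).1

lemma lowPassSchwartz_apply (n : ℕ) (x : ℝ) : lowPassSchwartz n x = lowPass (2 ^ n) x := rfl

/-- The function `φ_j` of the dyadic resolution of unity as a Schwartz function. -/
noncomputable def dyadicSchwartz : ℕ → 𝓢(ℝ, ℂ)
  | 0 => lowPassSchwartz 0
  | j + 1 => lowPassSchwartz (j + 1) - lowPassSchwartz j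

lemma dyadicSchwartz_apply (j : ℕ) (x : ℝ) : dyadicSchwartz j x = (dyadic j x : ℂ) := by
  rcases j with _ | j
  · rw [dyadic_zero_ofReal, dyadicSchwartz, lowPassSchwartz_apply, pow_zero]
  · rw [dyadic_succ_ofReal, dyadicSchwartz, sub_apply, lowPassSchwartz_apply, lowPassSchwartz_apply]

/-- The convolution kernel of the `j`-th Littlewood-Paley block. -/
noncomputable def kernel (j : ℕ) : 𝓢(ℝ, ℂ) := 𝓕⁻ (dyadicSchwartz j)

/-- The block convolves `δ_t` with the kernel, hence translates the kernel by `t`. The proof moves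
the inverse Fourier transform from `φ` to the modulated multiplier `f` by the multiplication
formula. -/
lemma block_delta {p : ℝ≥0∞} [Fact (1 ≤ p)] (j : ℕ) (t : ℝ) :
    block j (TemperedDistribution.delta t) =
      Lp.toTemperedDistribution ((SchwartzMap.compSubConstCLM ℂ t (kernel j)).toLp p volume) := by
  ext φ
  rw [Lp.toTemperedDistribution_toLp_eq]
  refine Eq.trans ?_ (SchwartzMap.toTemperedDistributionCLM_apply_apply volume
    (SchwartzMap.compSubConstCLM ℂ t (kernel j)) φ).symm
  rw [block_apply, TemperedDistribution.delta_apply]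
  let f : ℝ → ℂ := fun v =>
    Complex.exp ((-2 * Real.pi * v * t : ℝ) * Complex.I) * dyadicSchwartz j v
  have hf : Integrable f := by
    refine (dyadicSchwartz j).integrable.bdd_mul (c := 1) (by fun_prop) (.of_forall fun v => ?_)
    rw [Complex.norm_exp_ofReal_mul_I]
  have hfi : ∀ x, 𝓕⁻ f x = SchwartzMap.compSubConstCLM ℂ t (kernel j) x := fun x => by
    rw [SchwartzMap.compSubConstCLM_apply, kernel, SchwartzMap.fourierInv_coe,
      Real.fourierInv_eq', Real.fourierInv_eq']
    refine integral_congr_ae (.of_forall fun v => ?_)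
    simp only [f, smul_eq_mul]
    rw [← mul_assoc, ← Complex.exp_add]
    congr 2
    simp
    ring
  have h := VectorFourier.integral_fourierIntegral_smul_eq_flip (L := -innerₗ ℝ) (μ := volume)
    (ν := volume) Real.continuous_fourierChar (by fun_prop) hf φ.integrable
  have hflip : (-innerₗ ℝ).flip = -innerₗ ℝ := by
    ext
    simp
  rw [hflip] at h
  have h' : ∫ x, 𝓕⁻ f x • φ x = ∫ x, f x • 𝓕⁻ (φ : ℝ → ℂ) x := h
  simp_rw [← hfi]
  rw [SchwartzMap.fourier_coe, Real.fourier_real_eq_integral_exp_smul]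
  simp_rw [smul_eq_mul, mul_comm (φ _)] at h' ⊢
  rw [h']
  refine integral_congr_ae (.of_forall fun v => ?_)
  simp only [f]
  rw [SchwartzMap.smulLeftCLM_apply_apply (hasTemperateGrowth_dyadic j), SchwartzMap.fourierInv_coe,
    dyadicSchwartz_apply, smul_eq_mul]
  ring

/-- The inverse Fourier transform of the cut-off at scale `2^n`. -/
noncomputable def lowPassKernel (n : ℕ) : 𝓢(ℝ, ℂ) := 𝓕⁻ (lowPassSchwartz n)

lemma lowPassKernel_apply (n : ℕ) (x : ℝ) :
    lowPassKernel n x = 2 ^ n * lowPassKernel 0 (2 ^ n * x) := by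
  rw [lowPassKernel, lowPassKernel, SchwartzMap.fourierInv_coe, SchwartzMap.fourierInv_coe,
    Real.fourierInv_eq',
    Real.fourierInv_eq']
  have h := Measure.integral_comp_div (fun v : ℝ =>
    Complex.exp ((2 * Real.pi * (inner ℝ v (2 ^ n * x)) : ℝ) * Complex.I) • lowPassSchwartz 0 v)
    (2 ^ n)
  rw [abs_of_pos (by positivity), Complex.real_smul] at h
  push_cast at h
  push_cast
  rw [← h]
  refine integral_congr_ae (.of_forall fun v => ?_)
  simp only [lowPassSchwartz_apply, lowPass, pow_zero, div_one]
  congr 4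
  simp
  field_simp

/-- The kernel is `2^n` times a dilation by `2^n`, and the change of variables contributes
`2^{-n/p}`. -/
lemma eLpNorm_lowPassKernel {p : ℝ≥0∞} (n : ℕ) :
    eLpNorm (lowPassKernel n) p volume =
      ENNReal.ofReal ((2 ^ (1 - 1 / p.toReal)) ^ n) *
        eLpNorm (lowPassKernel 0) p volume := by
  have h2 : (0 : ℝ) < 2 ^ n := by positivity
  have hfun : ⇑(lowPassKernel n) =
      (2 ^ n : ℂ) • (lowPassKernel 0 ∘ (2 ^ n * ·)) := by
    funext x
    exact lowPassKernel_apply n x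
  have hmap := Real.map_volume_mul_left h2.ne'
  rw [hfun, eLpNorm_const_smul, ← eLpNorm_map_measure
    (lowPassKernel 0).continuous.aestronglyMeasurable (by fun_prop), hmap,
    eLpNorm_smul_measure_of_ne_zero (by positivity), smul_eq_mul, ← mul_assoc]
  congr 1
  have hn : ‖(2 ^ n : ℂ)‖ₑ = ENNReal.ofReal (2 ^ n) := by
    rw [← ofReal_norm]
    simp
  rw [hn, ENNReal.ofReal_rpow_of_pos (by positivity), ← ENNReal.ofReal_mul h2.le,
    abs_of_pos (by positivity)]
  congr 1
  rw [← Real.rpow_natCast, ← Real.rpow_natCast, ← Real.rpow_neg (by norm_num),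
    ← Real.rpow_mul (by norm_num), ← Real.rpow_mul (by norm_num), ← Real.rpow_add (by norm_num)]
  congr 1
  simp
  ring

lemma norm_toLp_compSubConst (p : ℝ≥0∞) (t : ℝ) (ψ : 𝓢(ℝ, ℂ)) :
    ‖(SchwartzMap.compSubConstCLM ℂ t ψ).toLp p volume‖ = ‖ψ.toLp p volume‖ := by
  rw [SchwartzMap.norm_toLp, SchwartzMap.norm_toLp]
  congr 1
  exact eLpNorm_comp_measurePreserving ψ.continuous.aestronglyMeasurable
    (measurePreserving_sub_right volume t)

variable {p : ℝ≥0∞} [Fact (1 ≤ p)]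

lemma continuous_toLp_compSubConst [Fact (p ≠ ∞)] (ψ : 𝓢(ℝ, ℂ)) :
    Continuous fun t => (SchwartzMap.compSubConstCLM ℂ t ψ).toLp p volume := by
  have h : ∀ t, (SchwartzMap.compSubConstCLM ℂ t ψ).toLp p volume =
      DomAddAct.mk (-t) +ᵥ (ψ.memLp p volume).toLp ψ := fun t => by
    rw [DomAddAct.mk_vadd_toLp]
    refine MemLp.toLp_congr _ _ (.of_forall fun x => ?_)
    simp [vadd_eq_add, neg_add_eq_sub]
  simp_rw [h]
  exact (DomAddAct.continuous_mk.comp continuous_neg).vadd continuous_const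

lemma norm_kernel_le (hp : p ≠ ∞) (j : ℕ) :
    ‖(kernel j).toLp p volume‖ ≤
      2 * ‖(lowPassKernel 0).toLp p volume‖ * (2 ^ (1 - 1 / p.toReal)) ^ j := by
  have hp1 : 1 ≤ p.toReal := by
    simpa using ENNReal.toReal_mono hp (Fact.out : 1 ≤ p)
  have hlow : ∀ n, ‖(lowPassKernel n).toLp p volume‖ =
      (2 ^ (1 - 1 / p.toReal)) ^ n * ‖(lowPassKernel 0).toLp p volume‖ := fun n => by
    rw [SchwartzMap.norm_toLp, SchwartzMap.norm_toLp, eLpNorm_lowPassKernel, ENNReal.toReal_mul,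
      ENNReal.toReal_ofReal (by positivity)]
  have h1 : (1 : ℝ) ≤ 2 ^ (1 - 1 / p.toReal) :=
    Real.one_le_rpow (by norm_num) (by
      rw [sub_nonneg, div_le_one (by linarith)]
      exact hp1)
  rcases j with _ | j
  · have h : kernel 0 = lowPassKernel 0 := rfl
    rw [h, pow_zero, mul_one]
    linarith [norm_nonneg ((lowPassKernel 0).toLp p volume)]
  · have h : kernel (j + 1) = lowPassKernel (j + 1) - lowPassKernel j := by
      rw [kernel, dyadicSchwartz, ← fourierInvCLM_apply (R := ℂ), map_sub]
      rfl
    rw [h, ← SchwartzMap.toLpCLM_apply (𝕜 := ℂ), map_sub, SchwartzMap.toLpCLM_apply,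
      SchwartzMap.toLpCLM_apply]
    refine (norm_sub_le _ _).trans ?_
    rw [hlow (j + 1), hlow j]
    have h2 : ((2 : ℝ) ^ (1 - 1 / p.toReal)) ^ j ≤ (2 ^ (1 - 1 / p.toReal)) ^ (j + 1) :=
      pow_le_pow_right₀ h1 (Nat.le_succ j)
    nlinarith [norm_nonneg ((lowPassKernel 0).toLp p volume)]

end

/-! ### The curve of Dirac masses -/

section DiracCurve

variable {p : ℝ≥0∞} [Fact (1 ≤ p)]

/-- Embedding each coordinate isometrically by `lp.single` reduces continuity to the Weierstrass
test; absolute summability is enough for every `p`. -/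
lemma exists_continuous_lp {X G : Type*} [TopologicalSpace X] [NormedAddCommGroup G]
    [NormedSpace ℝ G] [CompleteSpace G] {c : ℕ → X → G} (hc : ∀ j, Continuous (c j)) {u : ℕ → ℝ}
    (hu : Summable u) (hcu : ∀ j x, ‖c j x‖ ≤ u j) :
    ∃ a : X → lp (fun _ : ℕ => G) p, Continuous a ∧ ∀ x j, a x j = c j x := by
  have hp0 : 0 < p := zero_lt_one.trans_le Fact.out
  have hnorm : ∀ j x, ‖lp.single (E := fun _ : ℕ => G) p j (c j x)‖ ≤ u j := fun j x => by
    rw [lp.norm_single hp0]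
    exact hcu j x
  refine ⟨fun x => ∑' j, lp.single (E := fun _ : ℕ => G) p j (c j x), ?_, fun x j => ?_⟩
  · exact continuous_tsum
      (fun j => (lp.isometry_single (E := fun _ : ℕ => G) j).continuous.comp (hc j)) hu hnorm
  · have hs : Summable fun i => lp.single (E := fun _ : ℕ => G) p i (c i x) :=
      .of_norm_bounded hu fun i => hnorm i x
    have h := (lp.evalCLM ℝ (fun _ : ℕ => G) p j).map_tsum hs
    have h' : ∀ y, lp.evalCLM ℝ (fun _ : ℕ => G) p j y = y j := fun y => rfl
    rw [h'] at h
    rw [h, tsum_eq_single j]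
    · rw [h', lp.single_apply_self]
    · intro i hi
      rw [h', lp.single_apply_ne p i _ hi.symm]

/-- The weighted Littlewood-Paley blocks of the difference of two Dirac masses. -/
lemma exists_continuous_hasBlocks_delta_sub [Fact (p ≠ ∞)] {s : ℝ} (hs : s < 1 / p.toReal - 1) :
    ∃ a : ℝ → SeqLp p, Continuous a ∧ ∀ t, HasBlocks s
      (TemperedDistribution.delta t - TemperedDistribution.delta 0) (a t) := by
  let c : ℕ → ℝ → Lp ℂ p (volume : Measure ℝ) := fun j t =>
    (((2 : ℝ) ^ ((j : ℝ) * s) : ℝ) : ℂ) •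
      ((SchwartzMap.compSubConstCLM ℂ t (kernel j)).toLp p volume -
        (SchwartzMap.compSubConstCLM ℂ 0 (kernel j)).toLp p volume)
  -- The assumption `s < 1/p - 1` enters here: the weight `2^{js}` must beat the growth
  -- `2^{j(1-1/p)}` of the kernels. The constant 4 below counts two Dirac masses, each with the
  -- factor 2 of `norm_kernel_le`.
  have hr : (2 : ℝ) ^ (s + (1 - 1 / p.toReal)) < 1 :=
    Real.rpow_lt_one_of_one_lt_of_neg (by norm_num) (by linarith)
  have hu : Summable fun j : ℕ => 4 * ‖(lowPassKernel 0).toLp p volume‖ *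
      ((2 : ℝ) ^ (s + (1 - 1 / p.toReal))) ^ j :=
    (summable_geometric_of_lt_one (by positivity) hr).mul_left _
  obtain ⟨a, ha, hac⟩ := exists_continuous_lp (p := p) (c := c)
    (fun j => ((continuous_toLp_compSubConst (kernel j)).sub continuous_const).const_smul
      (((2 : ℝ) ^ ((j : ℝ) * s) : ℝ) : ℂ)) hu
    (fun j t => by
      have h2 : (0 : ℝ) < 2 ^ ((j : ℝ) * s) := Real.rpow_pos_of_pos (by norm_num) _
      have hn := norm_sub_le ((SchwartzMap.compSubConstCLM ℂ t (kernel j)).toLp p volume)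
        ((SchwartzMap.compSubConstCLM ℂ 0 (kernel j)).toLp p volume)
      rw [norm_toLp_compSubConst, norm_toLp_compSubConst] at hn
      have hk := norm_kernel_le (p := p) Fact.out j
      rw [norm_smul, Complex.norm_of_nonneg h2.le]
      calc _ ≤ (2 : ℝ) ^ ((j : ℝ) * s) * (2 * (2 * ‖(lowPassKernel 0).toLp p volume‖ *
            (2 ^ (1 - 1 / p.toReal)) ^ j)) := by
            gcongr
            linarith
        _ = _ := by
            rw [Real.rpow_add (by norm_num), mul_pow, mul_comm (j : ℝ), Real.rpow_mul (by norm_num),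
              Real.rpow_natCast]
            ring)
  refine ⟨a, ha, fun t j => ?_⟩
  rw [hac, map_sub, block_delta (p := p), block_delta (p := p)]
  refine Eq.symm ?_
  refine (map_smul (Lp.toTemperedDistributionCLM ℂ (volume : Measure ℝ) p) _ _).trans ?_
  rw [map_sub]
  rfl

/-- The primitive `-1_{(0,t]}` of the difference of two Dirac masses. -/
noncomputable def diracPrimitive (p : ℝ≥0∞) (t : ℝ) : Lp ℝ p (volume : Measure ℝ) :=
  indicatorConstLp p (measurableSet_Ioc (a := 0) (b := t)) measure_Ioc_lt_top.ne (-1)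

lemma continuous_diracPrimitive [Fact (p ≠ ∞)] : Continuous (diracPrimitive p) := by
  refine continuous_indicatorConstLp_set Fact.out fun x => ?_
  have hle : ∀ y : ℝ, volume (symmDiff (Set.Ioc 0 y) (Set.Ioc 0 x)) ≤ ENNReal.ofReal |y - x| := by
    intro y
    rw [← Real.volume_uIoc]
    refine measure_mono fun z hz => ?_
    simp only [Set.mem_symmDiff, Set.mem_Ioc, Set.mem_uIoc] at hz ⊢
    grind
  have h0 : Tendsto (fun y : ℝ => ENNReal.ofReal |y - x|) (𝓝 x) (𝓝 0) := by
    have h : Continuous fun y : ℝ => ENNReal.ofReal |y - x| := 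
      ENNReal.continuous_ofReal.comp (by fun_prop)
    simpa using h.tendsto x
  exact tendsto_of_tendsto_of_tendsto_of_le_of_le tendsto_const_nhds h0 (fun _ => zero_le) hle

lemma derivLp_diracPrimitive {t : ℝ} (ht : 0 ≤ t) :
    derivLp (diracPrimitive p t) =
      TemperedDistribution.delta t - TemperedDistribution.delta 0 := by
  ext φ
  rw [derivLp_apply]
  have h : ∫ x, deriv φ x * (diracPrimitive p t x : ℂ) = -∫ x in Set.Ioc 0 t, deriv φ x := by
    rw [← integral_indicator measurableSet_Ioc, ← integral_neg]
    refine integral_congr_ae ?_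
    filter_upwards [indicatorConstLp_coeFn (p := p) (μ := volume)
      (hs := measurableSet_Ioc (a := (0 : ℝ)) (b := t)) (hμs := measure_Ioc_lt_top.ne)
      (c := (-1 : ℝ))] with x hx
    rw [diracPrimitive, hx]
    by_cases hxt : x ∈ Set.Ioc 0 t <;> simp [hxt]
  have hd : Continuous (deriv φ) := (SchwartzMap.derivCLM ℂ ℂ φ).continuous
  rw [h, neg_neg, ← intervalIntegral.integral_of_le ht,
    intervalIntegral.integral_deriv_eq_sub (fun x _ => φ.differentiableAt)
      (hd.intervalIntegrable _ _)]
  rfl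

lemma restrictedDeriv_diracPrimitive {t : ℝ} (ht : 0 ≤ t) (φ : 𝓓(openUnitInterval, ℝ)) :
    restrictedDeriv (diracPrimitive p t) φ = φ t - φ 0 := by
  have h := isExtension_derivLp (diracPrimitive p t) φ
  rw [derivLp_diracPrimitive ht] at h
  have h' : ((φ t : ℝ) : ℂ) - ((φ 0 : ℝ) : ℂ) = restrictedDeriv (diracPrimitive p t) φ := h
  exact_mod_cast h'.symm

lemma testFunction_eq_zero (φ : 𝓓(openUnitInterval, ℝ)) {x : ℝ} (hx : x ∉ Set.Ioo (0 : ℝ) 1) :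
    φ x = 0 :=
  image_eq_zero_of_notMem_tsupport fun h => hx (φ.tsupport_subset h)

/-- A bounded continuous curve of primitives representing the Dirac masses on `(0,1)`. -/
lemma exists_diracCurve [Fact (p ≠ ∞)] {s : ℝ} (hs : s < 1 / p.toReal - 1) :
    ∃ D : ℝ → primitiveSpace s p, Continuous D ∧ (∃ C : ℝ≥0, ∀ t, ‖D t‖ ≤ C) ∧
      ∀ t (φ : 𝓓(openUnitInterval, ℝ)), (toBesov s p (D t)).toDistribution φ = φ t := by
  obtain ⟨a, ha, hab⟩ := exists_continuous_hasBlocks_delta_sub hs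
  -- The curve is built on the compact interval, which yields the uniform bound, and is then
  -- extended to the line by projection.
  let E : Set.Icc (0 : ℝ) 1 → primitiveSpace s p := fun t =>
    ⟨(diracPrimitive p t, a t), by
      change HasBlocks s (derivLp (diracPrimitive p t)) (a t)
      rw [derivLp_diracPrimitive t.2.1]
      exact hab t⟩
  have hE : Continuous E := ((continuous_diracPrimitive.comp continuous_subtype_val).prodMk
    (ha.comp continuous_subtype_val)).subtype_mk _
  obtain ⟨C, hC⟩ := isCompact_univ.exists_bound_of_continuousOn hE.continuousOn
  refine ⟨fun t => E (Set.projIcc 0 1 zero_le_one t), hE.comp continuous_projIcc,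
    ⟨C.toNNReal, fun t => (hC _ trivial).trans (Real.le_coe_toNNReal C)⟩, fun t φ => ?_⟩
  -- Test functions vanish at `0`, at `1` and outside the interval, which removes `δ_0` and makes
  -- the projected times harmless.
  rw [toDistribution_toBesov, restrictedDeriv_diracPrimitive (Set.projIcc 0 1 zero_le_one t).2.1,
    testFunction_eq_zero φ (x := 0) (by simp), sub_zero]
  rcases le_total t 0 with ht | ht
  · rw [Set.projIcc_of_le_left _ ht, testFunction_eq_zero φ (by simp),
      testFunction_eq_zero φ fun h => ht.not_gt h.1]
  rcases le_total 1 t with ht' | ht'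
  · rw [Set.projIcc_of_right_le _ ht', testFunction_eq_zero φ (by simp),
      testFunction_eq_zero φ fun h => ht'.not_gt h.2]
  · rw [Set.projIcc_of_mem _ ⟨ht, ht'⟩]

end DiracCurve

/-! ### Lévy measures and jump integrals -/

section LevyMeasure

variable {ν : Measure ℝ}

lemma measurableSet_lt_abs (ε : ℝ) : MeasurableSet {z : ℝ | ε < |z|} :=
  measurableSet_lt measurable_const measurable_norm

lemma measurableSet_abs_le (ε : ℝ) : MeasurableSet {z : ℝ | |z| ≤ ε} :=
  measurableSet_le measurable_norm measurable_const

lemma IsLevyMeasure.measure_lt_abs_ne_top (hν : IsLevyMeasure ν) {ε : ℝ} (hε : 0 < ε) :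
    ν {z | ε < |z|} ≠ ∞ := by
  have hc : ENNReal.ofReal (min 1 (ε ^ 2)) ≠ 0 := by
    rw [ENNReal.ofReal_ne_zero_iff]
    positivity
  have hlt : ν {z | ENNReal.ofReal (min 1 (ε ^ 2)) ≤ ENNReal.ofReal (min 1 (z ^ 2))} < ∞ :=
    (meas_ge_le_lintegral_div (by fun_prop) hc ENNReal.ofReal_ne_top).trans_lt
      (ENNReal.div_lt_top hν.lintegral_lt_top.ne hc)
  refine ((measure_mono fun z (hz : ε < |z|) => ?_).trans_lt hlt).ne
  change ENNReal.ofReal (min 1 (ε ^ 2)) ≤ ENNReal.ofReal (min 1 (z ^ 2))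
  rw [← sq_abs z]
  gcongr

lemma IsLevyMeasure.sigmaFinite (hν : IsLevyMeasure ν) : SigmaFinite ν := by
  refine ⟨⟨⟨fun n : ℕ => {0} ∪ {z | 1 / ((n : ℝ) + 1) < |z|}, fun _ => trivial, fun n => ?_, ?_⟩⟩⟩
  · refine (measure_union_le _ _).trans_lt ?_
    rw [hν.measure_zero, zero_add]
    exact (hν.measure_lt_abs_ne_top (by positivity)).lt_top
  · refine Set.eq_univ_of_forall fun z => Set.mem_iUnion.2 ?_
    by_cases hz : z = 0
    · exact ⟨0, .inl hz⟩
    · obtain ⟨n, hn⟩ := exists_nat_one_div_lt (abs_pos.2 hz)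
      exact ⟨n, .inr hn⟩

lemma homogeneousIntensity_restrict [SFinite ν] (S : Set ℝ) :
    (homogeneousIntensity ν).restrict (Set.Icc 0 1 ×ˢ S) =
      (volume.restrict (Set.Icc 0 1)).prod (ν.restrict S) := by
  rw [homogeneousIntensity, ← Measure.prod_restrict,
    Measure.restrict_restrict_of_subset Set.Icc_subset_Ici_self]

lemma homogeneousIntensity_Icc_prod [SFinite ν] (S : Set ℝ) :
    homogeneousIntensity ν (Set.Icc 0 1 ×ˢ S) = ν S := by
  rw [homogeneousIntensity, Measure.prod_prod, Measure.restrict_apply measurableSet_Icc,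
    Set.inter_eq_left.2 Set.Icc_subset_Ici_self, Real.volume_Icc]
  simp

lemma map_reflect_homogeneousIntensity [SFinite ν] (hsymm : ν.map (fun z => -z) = ν) :
    (homogeneousIntensity ν).map (Prod.map id fun z => -z) = homogeneousIntensity ν := by
  rw [homogeneousIntensity, ← Measure.map_prod_map _ _ measurable_id measurable_neg, Measure.map_id,
    hsymm]

lemma setLIntegral_snd_homogeneousIntensity [SFinite ν] (S : Set ℝ) {g : ℝ → ℝ≥0∞}
    (hg : Measurable g) :
    ∫⁻ x in Set.Icc 0 1 ×ˢ S, g x.2 ∂homogeneousIntensity ν = ∫⁻ z in S, g z ∂ν := by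
  rw [homogeneousIntensity_restrict, lintegral_prod _ (by fun_prop)]
  simp

end LevyMeasure

/-! ### Integrals of the Dirac curve over jumps, and their moments -/

section JumpIntegral

variable {Ω : Type*} [MeasurableSpace Ω] {P : Measure Ω} {ν : Measure ℝ}
  {η : Ω → Measure (ℝ × ℝ)}

/-- The finite number of jumps in `S` of size above `n` tends to zero and is an integer, so it is
eventually zero. Jumps are thus pathwise bounded without any moment of `ν` at infinity. -/
lemma ae_exists_measure_large_jumps_eq_zero [SFinite ν]
    (hη : IsPoissonRandomMeasure η (homogeneousIntensity ν) P) {S : Set ℝ} (hS : MeasurableSet S)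
    (hνS : ν S ≠ ∞) :
    ∀ᵐ ω ∂P, η ω (Set.Icc 0 1 ×ˢ S) < ∞ ∧
      ∃ n : ℕ, η ω (Set.Icc 0 1 ×ˢ (S ∩ {z | (n : ℝ) < |z|})) = 0 := by
  have hA : ∀ n : ℕ, MeasurableSet (Set.Icc (0 : ℝ) 1 ×ˢ (S ∩ {z | (n : ℝ) < |z|})) := fun n =>
    measurableSet_Icc.prod (hS.inter (measurableSet_lt_abs _))
  have hm : homogeneousIntensity ν (Set.Icc 0 1 ×ˢ S) ≠ ∞ := by
    rwa [homogeneousIntensity_Icc_prod]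
  have hnat := ae_all_iff.2 fun n : ℕ => hη.ae_exists_nat (hA n)
    ((measure_mono (Set.prod_mono_right Set.inter_subset_left)).trans_lt hm.lt_top).ne
  filter_upwards [hnat, hη.ae_lt_top (measurableSet_Icc.prod hS) hm] with ω hω hfin
  refine ⟨hfin, ?_⟩
  have hlim := tendsto_measure_iInter_atTop (μ := η ω) (fun n => (hA n).nullMeasurableSet)
    (fun k n hkn => Set.prod_mono_right (Set.inter_subset_inter_right _ 
      fun z (hz : (n : ℝ) < |z|) => (Nat.cast_le.2 hkn).trans_lt hz))
    ⟨0, ((measure_mono (Set.prod_mono_right Set.inter_subset_left)).trans_lt hfin).ne⟩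
  have hempty : ⋂ n : ℕ, Set.Icc (0 : ℝ) 1 ×ˢ (S ∩ {z | (n : ℝ) < |z|}) = ∅ := by
    refine Set.eq_empty_of_forall_notMem fun x hx => ?_
    obtain ⟨n, hn⟩ := exists_nat_ge |x.2|
    exact hn.not_gt (Set.mem_iInter.1 hx n).2.2
  rw [hempty, measure_empty] at hlim
  obtain ⟨n, hn⟩ := (hlim.eventually (gt_mem_nhds (zero_lt_one (α := ℝ≥0∞)))).exists
  obtain ⟨k, hk⟩ := hω n
  refine ⟨n, ?_⟩
  rw [Function.comp_apply, hk] at hn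
  rw [hk]
  have : k = 0 := by exact_mod_cast Nat.lt_one_iff.1 (by exact_mod_cast hn)
  rw [this, Nat.cast_zero]

variable {F : Type*} [NormedAddCommGroup F] [NormedSpace ℝ F]

lemma ae_integrableOn_smul_curve [SFinite ν]
    (hη : IsPoissonRandomMeasure η (homogeneousIntensity ν) P) {D : ℝ → F} (hD : Continuous D)
    {C : ℝ≥0} (hC : ∀ t, ‖D t‖ ≤ C) {S : Set ℝ} (hS : MeasurableSet S) (hνS : ν S ≠ ∞) :
    ∀ᵐ ω ∂P, IntegrableOn (fun x => x.2 • D x.1) (Set.Icc 0 1 ×ˢ S) (η ω) := by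
  filter_upwards [ae_exists_measure_large_jumps_eq_zero hη hS hνS] with ω hω
  obtain ⟨hfin, n, hn⟩ := hω
  refine Measure.integrableOn_of_bounded (M := n * C) hfin.ne
    (Continuous.aestronglyMeasurable (by fun_prop)) ?_
  rw [ae_restrict_iff' (measurableSet_Icc.prod hS)]
  filter_upwards [measure_eq_zero_iff_ae_notMem.1 hn] with x hx hxS
  have hxn : |x.2| ≤ n := not_lt.1 fun h => hx ⟨hxS.1, hxS.2, h⟩
  rw [norm_smul, Real.norm_eq_abs]
  gcongr
  exact hC _

/-- The integral of `z D(t)` over the jumps of size in `S` up to time one. -/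
noncomputable def jumpIntegral (D : ℝ → F) (S : Set ℝ) (η : Measure (ℝ × ℝ)) : F :=
  ∫ x in Set.Icc 0 1 ×ˢ S, x.2 • D x.1 ∂η

lemma ae_jumpIntegral_union [SFinite ν]
    (hη : IsPoissonRandomMeasure η (homogeneousIntensity ν) P) {D : ℝ → F} (hD : Continuous D)
    {C : ℝ≥0} (hC : ∀ t, ‖D t‖ ≤ C) {S T : Set ℝ} (hS : MeasurableSet S) (hνS : ν S ≠ ∞)
    (hT : MeasurableSet T) (hνT : ν T ≠ ∞) (hST : Disjoint S T) :
    ∀ᵐ ω ∂P, jumpIntegral D (S ∪ T) (η ω) = jumpIntegral D S (η ω) + jumpIntegral D T (η ω) := by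
  filter_upwards [ae_integrableOn_smul_curve hη hD hC hS hνS,
    ae_integrableOn_smul_curve hη hD hC hT hνT] with ω h1 h2
  rw [jumpIntegral, Set.prod_union]
  exact setIntegral_union (Set.disjoint_prod.2 (.inr hST)) (measurableSet_Icc.prod hT) h1 h2

lemma ae_map_jumpIntegral [CompleteSpace F] [SFinite ν] {G : Type*} [NormedAddCommGroup G]
    [NormedSpace ℝ G] [CompleteSpace G] (L : F →L[ℝ] G)
    (hη : IsPoissonRandomMeasure η (homogeneousIntensity ν) P) {D : ℝ → F} (hD : Continuous D)
    {C : ℝ≥0} (hC : ∀ t, ‖D t‖ ≤ C) {S : Set ℝ} (hS : MeasurableSet S) (hνS : ν S ≠ ∞) :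
    ∀ᵐ ω ∂P, L (jumpIntegral D S (η ω)) = jumpIntegral (fun t => L (D t)) S (η ω) := by
  filter_upwards [ae_integrableOn_smul_curve hη hD hC hS hνS] with ω h
  rw [jumpIntegral, ← L.integral_comp_comm h]
  simp_rw [map_smul]
  rfl

lemma aestronglyMeasurable_jumpIntegral [CompleteSpace F] [SecondCountableTopology F] [SFinite ν]
    (hη : IsPoissonRandomMeasure η (homogeneousIntensity ν) P) {D : ℝ → F} (hD : Continuous D)
    {C : ℝ≥0} (hC : ∀ t, ‖D t‖ ≤ C) {S : Set ℝ} (hS : MeasurableSet S) (hνS : ν S ≠ ∞) :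
    AEStronglyMeasurable (fun ω => jumpIntegral D S (η ω)) P := by
  borelize F
  exact hη.aestronglyMeasurable_setIntegral (Continuous.measurable (by fun_prop))
    (measurableSet_Icc.prod hS) (ae_integrableOn_smul_curve hη hD hC hS hνS)

lemma lintegral_jumpIntegral_rpow_le [IsProbabilityMeasure P] [CompleteSpace F]
    [SecondCountableTopology F] [SFinite ν]
    {q : ℝ} (hF : ClarksonInequality F q) (hq : 0 < q) (hq2 : q ≤ 2)
    (hsymm : ν.map (fun z => -z) = ν)
    (hη : IsPoissonRandomMeasure η (homogeneousIntensity ν) P) {D : ℝ → F} (hD : Continuous D)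
    {C : ℝ≥0} (hC : ∀ t, ‖D t‖ ≤ C) {S : Set ℝ} (hS : MeasurableSet S) (hνS : ν S ≠ ∞)
    (hSneg : ∀ z, -z ∈ S ↔ z ∈ S) (hS0 : 0 ∉ S) :
    ∫⁻ ω, ‖jumpIntegral D S (η ω)‖ₑ ^ q ∂P ≤
      2 * 2 ^ q * (C : ℝ≥0∞) ^ q * ∫⁻ z in S, ‖z‖ₑ ^ q ∂ν := by
  borelize F
  let σ : ℝ × ℝ → ℝ × ℝ := Prod.map id fun z => -z
  -- The positive jumps; their reflection gives the negative ones, and together they exhaust `S`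
  -- since `0 ∉ S`.
  let B : Set (ℝ × ℝ) := Set.Icc 0 1 ×ˢ (S ∩ Set.Ioi 0)
  have hB : MeasurableSet B := measurableSet_Icc.prod (hS.inter measurableSet_Ioi)
  have hBσ : Disjoint B (σ ⁻¹' B) := Set.disjoint_left.2 fun x hx hx' => by
    have h1 : 0 < x.2 := hx.2.2
    have h2 : 0 < -x.2 := hx'.2.2
    linarith
  have hunion : B ∪ σ ⁻¹' B = Set.Icc 0 1 ×ˢ S := by
    ext x
    have hx : x ∈ σ ⁻¹' B ↔ x.1 ∈ Set.Icc (0 : ℝ) 1 ∧ x.2 ∈ S ∧ x.2 < 0 := by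
      change x.1 ∈ Set.Icc (0 : ℝ) 1 ∧ -x.2 ∈ S ∧ 0 < -x.2 ↔ _
      rw [hSneg, neg_pos]
    rw [Set.mem_union, hx]
    change (x.1 ∈ Set.Icc (0 : ℝ) 1 ∧ x.2 ∈ S ∧ 0 < x.2) ∨ _ ↔ x.1 ∈ Set.Icc (0 : ℝ) 1 ∧ x.2 ∈ S
    have h0 : x.2 ∈ S → x.2 ≠ 0 := fun h h' => hS0 (h' ▸ h)
    grind
  have hmB : homogeneousIntensity ν B ≠ ∞ := by
    rw [homogeneousIntensity_Icc_prod]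
    exact ((measure_mono Set.inter_subset_left).trans_lt hνS.lt_top).ne
  have h := hη.lintegral_odd_rpow_le hF hq hq2 (σ := σ) (measurable_id.prodMap measurable_neg)
    (map_reflect_homogeneousIntensity hsymm) hB hBσ hmB (f := fun x => x.2 • D x.1)
    (Continuous.measurable (by fun_prop)) (fun x => neg_smul _ _) (by
      rw [hunion]
      exact ae_integrableOn_smul_curve hη hD hC hS hνS)
  rw [hunion] at h
  refine h.trans ?_
  rw [mul_assoc (2 * 2 ^ q)]
  gcongr
  calc ∫⁻ x in B, ‖x.2 • D x.1‖ₑ ^ q ∂homogeneousIntensity ν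
      ≤ ∫⁻ x in Set.Icc 0 1 ×ˢ S, (C : ℝ≥0∞) ^ q * ‖x.2‖ₑ ^ q ∂homogeneousIntensity ν := by
        refine (lintegral_mono_set (Set.prod_mono_right Set.inter_subset_left)).trans
          (lintegral_mono fun x => ?_)
        rw [enorm_smul, mul_comm, ENNReal.mul_rpow_of_nonneg _ _ hq.le]
        gcongr
        rw [← ofReal_norm, ← ENNReal.ofReal_coe_nnreal]
        exact ENNReal.ofReal_le_ofReal (hC _)
    _ = (C : ℝ≥0∞) ^ q * ∫⁻ z in S, ‖z‖ₑ ^ q ∂ν := by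
        rw [lintegral_const_mul _ (by fun_prop), setLIntegral_snd_homogeneousIntensity S
          (g := fun z => ‖z‖ₑ ^ q) (by fun_prop)]

end JumpIntegral

/-! ### The limiting noise -/

/-- `Y ε` itself need not lie in `L^p`, because large jumps may lack moments. Completeness of `L^p`
is therefore applied to `Y ε - Y 1`, along `ε = 1/(n+1)`, and `Y 1` is added back; `N` controls the
remaining `ε`. -/
lemma exists_tendsto_eLpNorm_sub {Ω V : Type*} [MeasurableSpace Ω] {P : Measure Ω}
    [NormedAddCommGroup V] [CompleteSpace V] {p : ℝ≥0∞} [Fact (1 ≤ p)] {Y : ℝ → Ω → V}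
    (hY : ∀ ε, 0 < ε → AEStronglyMeasurable (Y ε) P) {N : ℝ → ℝ≥0∞} (hN : Monotone N)
    (hN0 : Tendsto N (𝓝[>] 0) (𝓝 0)) (hN1 : N 1 ≠ ∞)
    (hYN : ∀ ε₁ ε₂, 0 < ε₁ → ε₁ ≤ ε₂ → ε₂ ≤ 1 → eLpNorm (Y ε₁ - Y ε₂) p P ≤ N ε₂) :
    ∃ Z : Ω → V, StronglyMeasurable Z ∧
      Tendsto (fun ε => eLpNorm (Y ε - Z) p P) (𝓝[>] 0) (𝓝 0) := by
  have hp1 : 1 ≤ p := Fact.out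
  let a : ℕ → ℝ := fun n => 1 / ((n : ℝ) + 1)
  have ha0 : ∀ n, 0 < a n := fun n => by positivity
  have ha1 : ∀ n, a n ≤ 1 := fun n => by
    rw [div_le_one (by positivity)]
    linarith [(Nat.cast_nonneg n : (0 : ℝ) ≤ n)]
  have hanti : Antitone a := fun m n hmn => by
    simp only [a]
    gcongr
  have ha : Tendsto a atTop (𝓝[>] 0) :=
    tendsto_nhdsWithin_iff.2 ⟨tendsto_one_div_add_atTop_nhds_zero_nat, .of_forall ha0⟩
  have hmem : ∀ n, MemLp (Y (a n) - Y 1) p P := fun n =>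
    ⟨(hY _ (ha0 n)).sub (hY 1 one_pos), (hYN _ _ (ha0 n) (ha1 n) le_rfl).trans_lt hN1.lt_top⟩
  have hcauchy : CauchySeq fun n => (hmem n).toLp := by
    rw [EMetric.cauchySeq_iff_le_tendsto_0]
    have hle : ∀ n m k : ℕ, k ≤ n → n ≤ m → edist (hmem n).toLp (hmem m).toLp ≤ N (a k) :=
      fun n m k hkn hnm => by
        rw [edist_comm, Lp.edist_toLp_toLp, sub_sub_sub_cancel_right]
        exact (hYN _ _ (ha0 m) (hanti hnm) (ha1 n)).trans (hN (hanti hkn))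
    refine ⟨fun k => N (a k), fun n m k hn hm => ?_, hN0.comp ha⟩
    rcases le_total n m with hnm | hnm
    · exact hle n m k hn hnm
    · rw [edist_comm]
      exact hle m n k hm hnm
  obtain ⟨W, hW⟩ := cauchySeq_tendsto_of_complete hcauchy
  have hlim : Tendsto (fun n => eLpNorm (Y (a n) - (Y 1 + ⇑W)) p P) atTop (𝓝 0) := by
    refine (tendsto_iff_edist_tendsto_0.1 hW).congr fun n => ?_
    rw [Lp.edist_def]
    refine eLpNorm_congr_ae ?_
    filter_upwards [(hmem n).coeFn_toLp] with ω hω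
    simp only [Pi.sub_apply, Pi.add_apply] at hω ⊢
    rw [hω, sub_sub]
  have hZ : AEStronglyMeasurable (Y 1 + ⇑W) P :=
    (hY 1 one_pos).add (Lp.aestronglyMeasurable W)
  refine ⟨hZ.mk, hZ.stronglyMeasurable_mk, ?_⟩
  have hbound : ∀ ε, 0 < ε → ε ≤ 1 → eLpNorm (Y ε - hZ.mk) p P ≤ N ε := fun ε hε hε1 => by
    have hcongr : eLpNorm (Y ε - hZ.mk) p P = eLpNorm (Y ε - (Y 1 + ⇑W)) p P :=
      eLpNorm_congr_ae (EventuallyEq.rfl.sub hZ.ae_eq_mk.symm)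
    rw [hcongr]
    have h := tendsto_const_nhds (x := N ε).add hlim
    rw [add_zero] at h
    refine ge_of_tendsto h ?_
    have hsmall : ∀ᶠ n in atTop, a n < ε :=
      tendsto_one_div_add_atTop_nhds_zero_nat.eventually (gt_mem_nhds hε)
    filter_upwards [hsmall] with n hn
    have htri := eLpNorm_add_le (μ := P) (f := Y ε - Y (a n)) (g := Y (a n) - (Y 1 + ⇑W))
      ((hY ε hε).sub (hY _ (ha0 n))) ((hY _ (ha0 n)).sub hZ) hp1
    rw [sub_add_sub_cancel] at htri
    refine htri.trans ?_
    gcongr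
    rw [eLpNorm_sub_comm]
    exact hYN _ _ (ha0 n) hn.le hε1
  refine tendsto_of_tendsto_of_tendsto_of_le_of_le' tendsto_const_nhds hN0
    (.of_forall fun _ => zero_le) ?_
  filter_upwards [Ioc_mem_nhdsGT zero_lt_one] with ε hε
  exact hbound ε hε.1 hε.2

/-- Continuity from above of the measure with density `|z|^q`, which is finite on `|z| ≤ 1` and does
not charge `{0}`. -/
lemma tendsto_setLIntegral_small_jumps {ν : Measure ℝ} (hν : ν {0} = 0) {q : ℝ}
    (hmom : ∫⁻ z in {z | |z| ≤ 1}, ‖z‖ₑ ^ q ∂ν < ∞) :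
    Tendsto (fun r : ℝ => ∫⁻ z in {z | |z| ≤ r}, ‖z‖ₑ ^ q ∂ν) (𝓝[>] 0) (𝓝 0) := by
  let ρ := ν.withDensity fun z => ‖z‖ₑ ^ q
  have hρ : ∀ r : ℝ, ρ {z | |z| ≤ r} = ∫⁻ z in {z | |z| ≤ r}, ‖z‖ₑ ^ q ∂ν := fun r =>
    withDensity_apply _ (measurableSet_abs_le r)
  have h := tendsto_measure_biInter_gt (μ := ρ) (s := fun r : ℝ => {z : ℝ | |z| ≤ r}) (a := 0)
    (fun r _ => (measurableSet_abs_le r).nullMeasurableSet)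
    (fun i j _ hij z (hz : |z| ≤ i) => hz.trans hij)
    ⟨1, one_pos, by rw [hρ]; exact hmom.ne⟩
  have hinter : ⋂ r > (0 : ℝ), {z : ℝ | |z| ≤ r} = {0} := by
    ext z
    simp only [Set.mem_iInter, Set.mem_singleton_iff]
    constructor
    · intro hz
      exact abs_eq_zero.1 (le_antisymm (le_of_forall_gt_imp_ge_of_dense hz) (abs_nonneg z))
    · rintro rfl r hr
      change |(0 : ℝ)| ≤ r
      rw [abs_zero]
      exact hr.le
  rw [hinter, withDensity_absolutelyContinuous _ _ hν] at h
  exact h.congr hρ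

/-! ### Jump integrals in the space of primitives -/

section Primitive

variable {Ω : Type*} [MeasurableSpace Ω] {P : Measure Ω} {p : ℝ≥0∞}
  [Fact (1 ≤ p)] {s : ℝ} {ν : Measure ℝ} [SFinite ν]
  {η : Ω → Measure (ℝ × ℝ)}

lemma exists_lintegral_jumpIntegral_primitive_le [IsProbabilityMeasure P] [Fact (p ≠ ∞)]
    (hp : p < 2) (hsymm : ν.map (fun z => -z) = ν)
    (hη : IsPoissonRandomMeasure η (homogeneousIntensity ν) P) {D : ℝ → primitiveSpace s p}
    (hD : Continuous D) {C : ℝ≥0} (hC : ∀ t, ‖D t‖ ≤ C) :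
    ∃ K : ℝ≥0, ∀ S, MeasurableSet S → ν S ≠ ∞ → (∀ z, -z ∈ S ↔ z ∈ S) → 0 ∉ S →
      ∫⁻ ω, ‖jumpIntegral D S (η ω)‖ₑ ^ p.toReal ∂P ≤ K * ∫⁻ z in S, ‖z‖ₑ ^ p.toReal ∂ν := by
  have hpt : p ≠ ∞ := Fact.out
  have hq : 0 < p.toReal := toReal_pos_of_fact hpt
  have hq2 : p.toReal ≤ 2 := by
    simpa using ENNReal.toReal_mono (by norm_num) hp.le
  have : SeparableSpace (SeqLp p) := separableSpace_lp hpt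
  have : SecondCountableTopology (SeqLp p) := UniformSpace.secondCountable_of_separable _
  have h1 : ClarksonInequality (Lp ℝ p (volume : Measure ℝ)) p.toReal :=
    (clarksonInequality_of_innerProductSpace ℝ hq.le hq2).Lp hpt
  have h2 : ClarksonInequality (SeqLp p) p.toReal :=
    ClarksonInequality.lp hpt fun _ =>
      (clarksonInequality_of_innerProductSpace ℂ hq.le hq2).Lp hpt
  let L1 : primitiveSpace s p →L[ℝ] Lp ℝ p (volume : Measure ℝ) :=
    ContinuousLinearMap.fst ℝ _ _ ∘L (primitiveSpace s p).subtypeL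
  let L2 : primitiveSpace s p →L[ℝ] SeqLp p :=
    ContinuousLinearMap.snd ℝ _ _ ∘L (primitiveSpace s p).subtypeL
  have hD1 : Continuous fun t => L1 (D t) := L1.continuous.comp hD
  have hD2 : Continuous fun t => L2 (D t) := L2.continuous.comp hD
  have hC1 : ∀ t, ‖L1 (D t)‖ ≤ C := fun t => (norm_fst_le (D t).1).trans (hC t)
  have hC2 : ∀ t, ‖L2 (D t)‖ ≤ C := fun t => (norm_snd_le (D t).1).trans (hC t)
  have hnorm : ∀ v : primitiveSpace s p,
      ‖v‖ₑ ^ p.toReal ≤ ‖L1 v‖ₑ ^ p.toReal + ‖L2 v‖ₑ ^ p.toReal := fun v => by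
    have hv : ‖v‖ = max ‖L1 v‖ ‖L2 v‖ := rfl
    rcases max_choice ‖L1 v‖ ‖L2 v‖ with h | h <;> rw [h] at hv
    · rw [← ofReal_norm v, hv, ofReal_norm]
      exact le_self_add
    · rw [← ofReal_norm v, hv, ofReal_norm]
      exact le_add_self
  -- The product carries the maximum norm, so the Clarkson bound is applied to the two components
  -- separately and the results are added; hence the outer 2.
  refine ⟨2 * (2 * 2 ^ p.toReal * C ^ p.toReal), fun S hS hνS hSneg hS0 => ?_⟩
  have e1 := lintegral_jumpIntegral_rpow_le h1 hq hq2 hsymm hη hD1 hC1 hS hνS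
    hSneg hS0
  have e2 := lintegral_jumpIntegral_rpow_le h2 hq hq2 hsymm hη hD2 hC2 hS hνS
    hSneg hS0
  have hmeas := (aestronglyMeasurable_jumpIntegral hη hD1 hC1 hS hνS).enorm
  calc ∫⁻ ω, ‖jumpIntegral D S (η ω)‖ₑ ^ p.toReal ∂P
      ≤ ∫⁻ ω, (‖jumpIntegral (fun t => L1 (D t)) S (η ω)‖ₑ ^ p.toReal +
          ‖jumpIntegral (fun t => L2 (D t)) S (η ω)‖ₑ ^ p.toReal) ∂P := by
        refine lintegral_mono_ae ?_
        filter_upwards [ae_map_jumpIntegral L1 hη hD hC hS hνS,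
          ae_map_jumpIntegral L2 hη hD hC hS hνS] with ω hω1 hω2
        rw [← hω1, ← hω2]
        exact hnorm _
    _ ≤ _ := by
        rw [lintegral_add_left' (hmeas.pow_const _)]
        refine (add_le_add e1 e2).trans_eq ?_
        rw [← two_mul, ← mul_assoc]
        congr 1
        push_cast
        rw [ENNReal.coe_rpow_of_nonneg _ hq.le, ENNReal.coe_rpow_of_nonneg _ hq.le]
        rfl

lemma ae_toDistribution_toBesov_jumpIntegral
    (hη : IsPoissonRandomMeasure η (homogeneousIntensity ν) P) {D : ℝ → primitiveSpace s p}
    (hD : Continuous D) {C : ℝ≥0} (hC : ∀ t, ‖D t‖ ≤ C)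
    (hDφ : ∀ t (φ : 𝓓(openUnitInterval, ℝ)), (toBesov s p (D t)).toDistribution φ = φ t) {ε : ℝ}
    (hε : ν {z | ε < |z|} ≠ ∞) :
    ∀ᵐ ω ∂P, IntegrableOn (fun x : ℝ × ℝ => x.2) (jumpSet ε) (η ω) ∧
      ∀ φ : 𝓓(openUnitInterval, ℝ),
        (toBesov s p (jumpIntegral D {z | ε < |z|} (η ω))).toDistribution φ =
          truncatedNoise (η ω) ε φ := by
  filter_upwards [ae_integrableOn_smul_curve hη hD hC (measurableSet_lt_abs ε) hε,
    ae_integrableOn_smul_curve hη (continuous_const (y := (1 : ℝ))) (C := 1) (by simp)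
      (measurableSet_lt_abs ε) hε] with ω h1 h2
  refine ⟨by simpa [jumpSet] using h2, fun φ => ?_⟩
  obtain ⟨ℓ, hℓ⟩ := exists_continuousLinearMap_apply_eq (p := p) s φ
  -- A test function acts as a continuous functional on primitives, so it commutes with the Bochner
  -- integral. The exceptional null set comes from integrability alone and does not depend on `φ`.
  have h := (ℓ ∘L toBesov s p).integral_comp_comm h1
  rw [← hℓ]
  refine h.symm.trans ?_
  rw [truncatedNoise, jumpSet]
  refine integral_congr_ae (.of_forall fun x => ?_)
  simp only [map_smul, ContinuousLinearMap.comp_apply]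
  rw [hℓ, hDφ, smul_eq_mul, mul_comm]

end Primitive

end LevyNoise

/-! ### The truncated noises, their limit and its Radon law -/

open LevyNoise in
theorem propositionA1 {Ω : Type*} [MeasurableSpace Ω] (P : Measure Ω) [IsProbabilityMeasure P]
    (p : ℝ≥0∞) [Fact (1 ≤ p)] (hp : p < 2) (s : ℝ) (hs : s < 1 / p.toReal - 1)
    (ν : Measure ℝ) (hν : IsLevyMeasure ν) (hsymm : ν.map (fun z => -z) = ν)
    (hmom : ∫⁻ z in {z | |z| ≤ 1}, ‖z‖ₑ ^ p.toReal ∂ν < ∞)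
    (η : Ω → Measure (ℝ × ℝ)) (hη : IsPoissonRandomMeasure η (homogeneousIntensity ν) P) :
    (∀ φ : 𝓓(openUnitInterval, ℝ), ∃ ℓ : Besov s p →L[ℝ] ℝ, ∀ x, ℓ x = x.toDistribution φ) ∧
    ∃ (X : ℝ → Ω → Besov s p) (ξ : (Besov s p →L[ℝ] ℝ) → Ω → ℝ) (μ : Measure (Besov s p)),
      (∀ ε, 0 < ε → ε ≤ 1 → Measurable (X ε) ∧ ∀ᵐ ω ∂P,
        IntegrableOn (fun x : ℝ × ℝ => x.2) (jumpSet ε) (η ω) ∧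
        ∀ φ : 𝓓(openUnitInterval, ℝ), (X ε ω).toDistribution φ = truncatedNoise (η ω) ε φ) ∧
      (∀ ℓ, Measurable (ξ ℓ) ∧ TendstoInMeasure P (fun ε ω => ℓ (X ε ω)) (𝓝[>] 0) (ξ ℓ)) ∧
      (IsProbabilityMeasure μ ∧ μ.InnerRegular ∧
        ∀ (n : ℕ) (ℓ : Fin n → Besov s p →L[ℝ] ℝ) (C : Set (Fin n → ℝ)), MeasurableSet C →
          μ {x | (fun i => ℓ i x) ∈ C} = P {ω | (fun i => ξ (ℓ i) ω) ∈ C}) ∧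
      (∫⁻ z in {z | 1 < |z|}, ‖z‖ₑ ^ p.toReal ∂ν < ∞ →
        ∃ c : ℝ≥0, ∀ ε, 0 < ε → ε ≤ 1 → ∫⁻ ω, ‖X ε ω‖ₑ ^ p.toReal ∂P ≤ c) ∧
      (∃ c : ℝ≥0, ∀ ε₁ ε₂, 0 < ε₁ → ε₁ ≤ ε₂ → ε₂ ≤ 1 →
        ∫⁻ ω, ‖X ε₁ ω - X ε₂ ω‖ₑ ^ p.toReal ∂P ≤
          c * ∫⁻ z in {z | ε₁ < |z| ∧ |z| ≤ ε₂}, ‖z‖ₑ ^ p.toReal ∂ν) := by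
  have hpt : p ≠ ∞ := hp.ne_top
  have : Fact (p ≠ ∞) := ⟨hpt⟩
  have hp0 : p ≠ 0 := (zero_lt_one.trans_le (Fact.out : 1 ≤ p)).ne'
  have hq : 0 < p.toReal := toReal_pos_of_fact hpt
  have := hν.sigmaFinite
  refine ⟨exists_continuousLinearMap_apply_eq s, ?_⟩
  obtain ⟨D, hD, ⟨C, hC⟩, hDφ⟩ := exists_diracCurve hs
  obtain ⟨K, hK⟩ := exists_lintegral_jumpIntegral_primitive_le hp hsymm hη hD hC
  let J : ℝ → Ω → primitiveSpace s p := fun ε ω => jumpIntegral D {z | ε < |z|} (η ω)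
  have hJm : ∀ ε, 0 < ε → AEStronglyMeasurable (J ε) P := fun ε hε =>
    aestronglyMeasurable_jumpIntegral hη hD hC (measurableSet_lt_abs ε)
      (hν.measure_lt_abs_ne_top hε)
  have hring : ∀ ε₁ ε₂ : ℝ, MeasurableSet {z : ℝ | ε₁ < |z| ∧ |z| ≤ ε₂} := fun ε₁ ε₂ =>
    (measurableSet_lt_abs ε₁).inter (measurableSet_abs_le ε₂)
  have hringν : ∀ ε₁ ε₂ : ℝ, 0 < ε₁ → ν {z : ℝ | ε₁ < |z| ∧ |z| ≤ ε₂} ≠ ∞ := fun ε₁ ε₂ hε =>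
    ((measure_mono fun z hz => hz.1).trans_lt (hν.measure_lt_abs_ne_top hε).lt_top).ne
  have hdiff : ∀ ε₁ ε₂, 0 < ε₁ → ε₁ ≤ ε₂ → ∫⁻ ω, ‖J ε₁ ω - J ε₂ ω‖ₑ ^ p.toReal ∂P ≤
      K * ∫⁻ z in {z | ε₁ < |z| ∧ |z| ≤ ε₂}, ‖z‖ₑ ^ p.toReal ∂ν := fun ε₁ ε₂ hε h12 => by
    have hunion : {z : ℝ | ε₁ < |z|} = {z | ε₁ < |z| ∧ |z| ≤ ε₂} ∪ {z | ε₂ < |z|} := by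
      ext z
      change ε₁ < |z| ↔ (ε₁ < |z| ∧ |z| ≤ ε₂) ∨ ε₂ < |z|
      grind
    have hdisj : Disjoint {z : ℝ | ε₁ < |z| ∧ |z| ≤ ε₂} {z | ε₂ < |z|} :=
      Set.disjoint_left.2 fun z hz hz' => hz.2.not_gt hz'
    have hae := ae_jumpIntegral_union hη hD hC (hring ε₁ ε₂) (hringν ε₁ ε₂ hε)
      (measurableSet_lt_abs ε₂) (hν.measure_lt_abs_ne_top (hε.trans_le h12)) hdisj
    refine (lintegral_congr_ae ?_).trans_le (hK _ (hring ε₁ ε₂) (hringν ε₁ ε₂ hε) (fun z => ?_) ?_)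
    · filter_upwards [hae] with ω hω
      simp only [J]
      rw [hunion, hω, add_sub_cancel_right]
    · change (ε₁ < |-z| ∧ |-z| ≤ ε₂) ↔ _
      rw [abs_neg]
      rfl
    · intro h
      have h' : ε₁ < |(0 : ℝ)| := h.1
      rw [abs_zero] at h'
      exact hε.not_gt h'
  -- Enlarging the ring `ε₁ < |z| ≤ ε₂` to `|z| ≤ ε₂` gives a Cauchy modulus that depends on `ε₂`
  -- only.
  let N : ℝ → ℝ≥0∞ := fun r =>
    (K * ∫⁻ z in {z | |z| ≤ r}, ‖z‖ₑ ^ p.toReal ∂ν) ^ (1 / p.toReal)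
  have hNmono : Monotone N := fun r r' hr => by
    simp only [N]
    gcongr
  have hN0 : Tendsto N (𝓝[>] 0) (𝓝 0) := by
    have h := ENNReal.Tendsto.const_mul (a := K)
      (tendsto_setLIntegral_small_jumps hν.measure_zero hmom) (.inr ENNReal.coe_ne_top)
    have h' := (ENNReal.continuous_rpow_const (y := 1 / p.toReal)).tendsto 0
    rw [mul_zero] at h
    rw [ENNReal.zero_rpow_of_pos (by positivity)] at h'
    exact h'.comp h
  have hN1 : N 1 ≠ ∞ :=
    ENNReal.rpow_ne_top_of_nonneg (by positivity) (ENNReal.mul_ne_top ENNReal.coe_ne_top hmom.ne)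
  obtain ⟨Y, hY, hJY⟩ := exists_tendsto_eLpNorm_sub (p := p) hJm hNmono hN0 hN1
    fun ε₁ ε₂ hε h12 _ => by
      rw [eLpNorm_eq_lintegral_rpow_enorm_toReal hp0 hpt]
      refine ENNReal.rpow_le_rpow ((hdiff ε₁ ε₂ hε h12).trans ?_) (by positivity)
      gcongr
      exact And.right
  -- The jump integrals are only almost everywhere strongly measurable, so a measurable modification
  -- is chosen for each `ε > 0`, with `0` as default otherwise.
  have hJ' : ∀ ε, ∃ J' : Ω → primitiveSpace s p, StronglyMeasurable J' ∧
      (0 < ε → J' =ᵐ[P] J ε) := fun ε => by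
    by_cases hε : 0 < ε
    · exact ⟨(hJm ε hε).mk, (hJm ε hε).stronglyMeasurable_mk, fun _ => (hJm ε hε).ae_eq_mk.symm⟩
    · exact ⟨0, stronglyMeasurable_zero, fun h => absurd h hε⟩
  choose J' hJ'm hJ'J using hJ'
  have hX : ∀ ε, StronglyMeasurable fun ω => toBesov s p (J' ε ω) := fun ε =>
    (toBesov s p).continuous.comp_stronglyMeasurable (hJ'm ε)
  have hXY : StronglyMeasurable fun ω => toBesov s p (Y ω) :=
    (toBesov s p).continuous.comp_stronglyMeasurable hY
  have hnorm : ∀ v : primitiveSpace s p, ‖toBesov s p v‖ₑ ≤ ‖v‖ₑ := fun v => by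
    rw [← ofReal_norm, ← ofReal_norm]
    exact ENNReal.ofReal_le_ofReal (norm_toBesovFun_le v)
  refine ⟨fun ε ω => toBesov s p (J' ε ω), fun ℓ ω => ℓ (toBesov s p (Y ω)),
    P.map fun ω => toBesov s p (Y ω), fun ε hε _ => ⟨(hX ε).measurable, ?_⟩, fun ℓ => ⟨?_, ?_⟩,
    ⟨Measure.isProbabilityMeasure_map hXY.measurable.aemeasurable, ?_, fun n ℓ A hA => ?_⟩,
    fun hlarge => ?_, K, fun ε₁ ε₂ hε h12 _ => ?_⟩
  · filter_upwards [hJ'J ε hε, ae_toDistribution_toBesov_jumpIntegral hη hD hC hDφ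
      (hν.measure_lt_abs_ne_top hε)] with ω hω hω'
    rw [hω]
    exact hω'
  · exact (ℓ.continuous.comp_stronglyMeasurable hXY).measurable
  · refine tendstoInMeasure_of_tendsto_eLpNorm hp0
      (fun ε => (ℓ.continuous.comp_stronglyMeasurable (hX ε)).aestronglyMeasurable)
      (ℓ.continuous.comp_stronglyMeasurable hXY).aestronglyMeasurable ?_
    have h := ENNReal.Tendsto.const_mul (a := ENNReal.ofReal ‖ℓ ∘L toBesov s p‖) hJY
      (.inr ENNReal.ofReal_ne_top)
    rw [mul_zero] at h
    refine tendsto_of_tendsto_of_tendsto_of_le_of_le' tendsto_const_nhds h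
      (.of_forall fun _ => zero_le) ?_
    filter_upwards [self_mem_nhdsWithin] with ε hε
    refine eLpNorm_le_mul_eLpNorm_of_ae_le_mul ?_ p
    filter_upwards [hJ'J ε hε] with ω hω
    simp only [Pi.sub_apply]
    rw [hω, ← map_sub, ← map_sub]
    exact (ℓ ∘L toBesov s p).le_opNorm _
  -- The law of `Y` is inner regular because `primitiveSpace` is complete and separable; compact
  -- sets are then pushed forward by `toBesov`.
  · borelize ↥(primitiveSpace s p)
    have hmap : P.map (fun ω => toBesov s p (Y ω)) = (P.map Y).map (toBesov s p) :=
      (Measure.map_map (toBesov s p).continuous.measurable hY.measurable).symm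
    have : IsProbabilityMeasure (P.map Y) :=
      Measure.isProbabilityMeasure_map hY.measurable.aemeasurable
    rw [hmap]
    exact Measure.InnerRegular.map_of_continuous (toBesov s p).continuous
  · have hmeas : MeasurableSet {x : Besov s p | (fun i => ℓ i x) ∈ A} :=
      (measurable_pi_lambda _ fun i => (ℓ i).continuous.measurable) hA
    exact Measure.map_apply hXY.measurable hmeas
  · let M : ℝ≥0∞ := K * (∫⁻ z in {z | |z| ≤ 1}, ‖z‖ₑ ^ p.toReal ∂ν +
      ∫⁻ z in {z | 1 < |z|}, ‖z‖ₑ ^ p.toReal ∂ν)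
    have hM : M ≠ ∞ := ENNReal.mul_ne_top ENNReal.coe_ne_top
      (ENNReal.add_ne_top.2 ⟨hmom.ne, hlarge.ne⟩)
    refine ⟨M.toNNReal, fun ε hε _ => ?_⟩
    rw [ENNReal.coe_toNNReal hM]
    calc ∫⁻ ω, ‖toBesov s p (J' ε ω)‖ₑ ^ p.toReal ∂P ≤ ∫⁻ ω, ‖J ε ω‖ₑ ^ p.toReal ∂P := by
          refine lintegral_mono_ae ?_
          filter_upwards [hJ'J ε hε] with ω hω
          rw [hω]
          exact ENNReal.rpow_le_rpow (hnorm _) hq.le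
      _ ≤ K * ∫⁻ z in {z | ε < |z|}, ‖z‖ₑ ^ p.toReal ∂ν := by
          refine hK _ (measurableSet_lt_abs ε) (hν.measure_lt_abs_ne_top hε) (fun z => ?_) ?_
          · change ε < |-z| ↔ _
            rw [abs_neg]
            rfl
          · intro h
            have h' : ε < |(0 : ℝ)| := h
            rw [abs_zero] at h'
            exact hε.not_gt h'
      _ ≤ M := by
          simp only [M]
          gcongr
          refine (lintegral_mono_set fun z _ => ?_).trans (lintegral_union_le _ _ _)
          exact le_or_gt |z| 1
  · refine (lintegral_mono_ae ?_).trans (hdiff ε₁ ε₂ hε h12)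
    filter_upwards [hJ'J ε₁ hε, hJ'J ε₂ (hε.trans_le h12)] with ω h1 h2
    rw [h1, h2, ← map_sub]
    exact ENNReal.rpow_le_rpow (hnorm _) hq.le
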